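/- **Regret bound for Private-UCB-VI.** *Setting.* Consider a finite-horizon MDP with finite state set $\mathcal S$ ($|\mathcal S|=S$), finite action set $\mathcal A$ ($|\mathcal A|=A\ge1$), horizon $H\ge1$, transition probabilities $P_h(s'|s,a)$ and mean costs $c_h(s,a)\in[0,1]$, $h=1,\dots,H$. A learner plays $K\ge1$ episodes, with fixed (history-independent) initial states $s_1^k$; put $T=KH$. In episode $k$ it plays a policy $\pi^k$ and observes $(s_h^k,a_h^k,c_h^k,s_{h+1}^k)_{h\le H}$, where, given the past, $s_{h+1}^k\sim P_h(\cdot|s_h^k,a_h^k)$ and $c_h^k\in[0,1]$ has mean $c_h(s_h^k,a_h^k)$. With $V_1^\pi(s)$ the expected total cost of policy $\pi$ from $s$ and $V_1^*=\min_\pi V_1^\pi$ (over all randomized non-stationary policies), the regret is $\mathcal R(T)=\sum_{k=1}^K\big[V_1^{\pi^k}(s_1^k)-V_1^*(s_1^k)\big]$. Let $N_h^k(s,a)$, $N_h^k(s,a,s')$, $C_h^k(s,a)$ be the numbers of visits, numbers of transitions and total costs at step $h$ before episode $k$. *Privatizer.* Before each episode $k\ge2$ a privatizer releases real-valued private counts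 $\widetilde N_h^k(s,a),\widetilde N_h^k(s,a,s'),\widetilde C_h^k(s,a)$ that may depend in any way on the past episodes and on internal randomness (the private counts at $k=1$ are $0$). Its precision levels at privacy level $\epsilon$ and confidence level $\delta'\in(0,1]$ are $E_{\epsilon,\delta',1},E_{\epsilon,\delta',2}>0$. *Assumption at level $\delta'$:* with probability at least $1-\delta'$, for all $(s,a,s',h,k)$, $|\widetilde N_h^k(s,a)-N_h^k(s,a)|\le E_{\epsilon,\delta',1}$, $|\widetilde C_h^k(s,a)-C_h^k(s,a)|\le E_{\epsilon,\delta',1}$ and $|\widetilde N_h^k(s,a,s')-N_h^k(s,a,s')|\le E_{\epsilon,\delta',2}$. *Algorithm with input confidence level $\delta'$.* Write $E_i=E_{\epsilon,\delta',i}$, $D_h^k(s,a)=\max\{1,\widetilde N_h^k(s,a)+E_1\}$, $\widetilde c_h^k=\widetilde C_h^k/D_h^k$, $\widetilde P_h^k(s'|s,a)=\widetilde N_h^k(s,a,s')/D_h^k(s,a)$, $L_c=\sqrt{2\ln(4SAT/\delta')}$, $$\beta_h^{k,c}=\frac{L_c}{\sqrt{D_h^k}}+\frac{3E_1}{D_h^k},\qquad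 \beta_h^{k,pv}=\frac{HL_c}{\sqrt{D_h^k}}+\frac{H(SE_2+2E_1)}{D_h^k}.$$ In episode $k$, starting from $\widetilde V_{H+1}^k=0$, compute for $h=H,\dots,1$ $$\widetilde Q_h^k(s,a)=\min\Big\{H-h+1,\max\Big\{0,\widetilde c_h^k(s,a)+\sum_{s'}\widetilde V_{h+1}^k(s')\widetilde P_h^k(s'|s,a)-\beta_h^{k,c}(s,a)-\beta_h^{k,pv}(s,a)\Big\}\Big\},\quad \widetilde V_h^k(s)=\min_a\widetilde Q_h^k(s,a),$$ and play $\pi_h^k(s)\in\arg\min_a\widetilde Q_h^k(s,a)$, ties broken arbitrarily. *Theorem.* There are universal constants $C>0$ and $p\in\mathbb N$ such that the following holds for all such MDPs, $K$, $\epsilon>0$, $\delta\in(0,1]$ and privatizers. Run the algorithm with input confidence level $\delta/2$, and suppose that the privatizer satisfies the Assumption at level $\delta/2$. Then with probability at least $1-\delta$, $$\mathcal R(T)\le C\Big(\sqrt{SAH^3T}+S^2AH^3+S^2AH^2E_{\epsilon,\delta/2,1}+S^2AH^2E_{\epsilon,\delta/2,2}\Big)\Big(\log\frac{6SAT}{\delta}\Big)^{p},$$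 that is, $\mathcal R(T)=\widetilde O\big(\sqrt{SAH^3T}+S^2AH^3\big)+\widetilde O\big(S^2AH^2E_{\epsilon,\delta/2,1}+S^2AH^2E_{\epsilon,\delta/2,2}\big)$, where $\widetilde O$ hides factors polylogarithmic in $S,A,T,1/\delta$. -/

import Mathlib

open MeasureTheory

namespace PrivateRL

/-! ### Episodic tabular MDPs, policies, values -/

/-- A finite-horizon MDP with horizon `H` (step `h : Fin H` is step `h + 1` in one-based counting):
transition probabilities `P h s a s'` and mean costs `c h s a` of cost distributions supported
on `[0, 1]`. -/
structure MDP (S A : Type*) [Fintype S] (H : ℕ) where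
  P : Fin H → S → A → S → ℝ
  c : Fin H → S → A → ℝ
  P_nonneg : ∀ h s a s', 0 ≤ P h s a s'
  P_sum : ∀ h s a, ∑ s', P h s a s' = 1
  c_nonneg : ∀ h s a, 0 ≤ c h s a
  c_le_one : ∀ h s a, c h s a ≤ 1

/-- A (randomized, non-stationary) policy: `prob h s a` is the probability of playing `a` in `s`
at step `h`. -/
structure Policy (S A : Type*) [Fintype A] (H : ℕ) where
  prob : Fin H → S → A → ℝ
  prob_nonneg : ∀ h s a, 0 ≤ prob h s a
  prob_sum : ∀ h s, ∑ a, prob h s a = 1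

open Classical in
/-- The policy that plays `π h s` in state `s` at step `h`. -/
noncomputable def Policy.deterministic {S A : Type*} [Fintype A] {H : ℕ} (π : Fin H → S → A) :
    Policy S A H where
  prob h s a := if π h s = a then 1 else 0
  prob_nonneg h s a := by split_ifs <;> norm_num
  prob_sum h s := by simp

section Value

variable {S A : Type*} [Fintype S] [Fintype A] {H : ℕ}

open Classical in
/-- Probability that an episode started in `s` and played with `π` visits the states
`x 0, …, x H` and uses the actions `a 0, …, a (H - 1)`. -/
noncomputable def MDP.trajProb (M : MDP S A H) (π : Policy S A H) (s : S)
    (x : Fin (H + 1) → S) (a : Fin H → A) : ℝ :=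
  (if x 0 = s then 1 else 0) *
    ∏ h, (π.prob h (x h.castSucc) (a h) * M.P h (x h.castSucc) (a h) (x h.succ))

/-- `V_1^π(s)`: the expected total cost of an episode started in `s` and played with `π`. -/
noncomputable def MDP.value (M : MDP S A H) (π : Policy S A H) (s : S) : ℝ :=
  ∑ x : Fin (H + 1) → S, ∑ a : Fin H → A,
    M.trajProb π s x a * ∑ h, M.c h (x h.castSucc) (a h)

/-- `V_1^*(s)`: the optimal (smallest) value over all non-stationary policies. -/
noncomputable def MDP.optValue (M : MDP S A H) (s : S) : ℝ :=
  ⨅ π : Policy S A H, M.value π s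

end Value

/-! ### The learner's computations, from released counts -/

/-- Counts, private or not: total cost `C h s a`, visits `N h s a`, transitions `N₃ h s a s'`. -/
structure Counts (S A : Type*) (H : ℕ) where
  C : Fin H → S → A → ℝ
  N : Fin H → S → A → ℝ
  N₃ : Fin H → S → A → S → ℝ

/-- The input of the algorithm: number of episodes, confidence level, and the two precision levels
of the privatizer at the privacy and confidence levels in use. -/
structure Params where
  K : ℕ
  δ : ℝ
  E₁ : ℝ
  E₂ : ℝ

section Algorithm

variable {S A : Type*} {H : ℕ}

/-- `max {1, Ñ + E₁}`. -/
noncomputable def denom (p : Params) (n : Counts S A H) (h : Fin H) (s : S) (a : A) : ℝ :=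
  max 1 (n.N h s a + p.E₁)

/-- Private empirical mean cost. -/
noncomputable def cTilde (p : Params) (n : Counts S A H) (h : Fin H) (s : S) (a : A) : ℝ :=
  n.C h s a / denom p n h s a

/-- Private empirical transition probabilities. -/
noncomputable def PTilde (p : Params) (n : Counts S A H) (h : Fin H) (s : S) (a : A) (s' : S) : ℝ :=
  n.N₃ h s a s' / denom p n h s a

variable [Fintype S] [Fintype A]

variable (S A H) in
/-- `L_c(δ) = √(2 ln (4 S A T / δ))` with `T = K H`. -/
noncomputable def Lc (p : Params) : ℝ :=
  Real.sqrt (2 * Real.log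
    (4 * (Fintype.card S : ℝ) * (Fintype.card A : ℝ) * ((p.K : ℝ) * (H : ℝ)) / p.δ))

/-- Bonus `β^{k,c}` for the costs. -/
noncomputable def bonusC (p : Params) (n : Counts S A H) (h : Fin H) (s : S) (a : A) : ℝ :=
  Lc S A H p / Real.sqrt (denom p n h s a) + 3 * p.E₁ / denom p n h s a

/-- Bonus `β^{k,pv}` for the transitions, applied to the optimal value function. -/
noncomputable def bonusPV (p : Params) (n : Counts S A H) (h : Fin H) (s : S) (a : A) : ℝ :=
  H * Lc S A H p / Real.sqrt (denom p n h s a) +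
    H * ((Fintype.card S : ℝ) * p.E₂ + 2 * p.E₁) / denom p n h s a

/-- One optimistic Bellman backup with truncation to `[0, H - h]` (`h` is zero-based), given the
estimate `V` of the value function at the next step. -/
noncomputable def qBackup (p : Params) (n : Counts S A H) (h : Fin H) (V : S → ℝ)
    (s : S) (a : A) : ℝ :=
  min ((H : ℝ) - (h : ℕ)) (max 0
    (cTilde p n h s a + ∑ s', V s' * PTilde p n h s a s' -
      (bonusC p n h s a + bonusPV p n h s a)))

/-- Private value estimates `Ṽ_h`, by backward recursion from `Ṽ = 0` after the last step. -/
noncomputable def vTilde [Nonempty A] (p : Params) (n : Counts S A H) : Fin (H + 1) → S → ℝ :=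
  Fin.reverseInduction (motive := fun _ => S → ℝ) (fun _ => 0)
    (fun h V s => Finset.univ.inf' Finset.univ_nonempty (fun a => qBackup p n h V s a))

/-- Private Q-estimates `Q̃_h`. -/
noncomputable def qTilde [Nonempty A] (p : Params) (n : Counts S A H) (h : Fin H)
    (s : S) (a : A) : ℝ :=
  qBackup p n h (vTilde p n h.succ) s a

end Algorithm

/-! ### The interaction -/

/-- The random variables of `K` episodes on a sample space `Ω`: states, costs, the deterministic
policy played in each episode, and the private counts available at the beginning of each episode. -/
structure Run (Ω S A : Type*) (H K : ℕ) where
  state : Fin K → Fin (H + 1) → Ω → S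
  cost : Fin K → Fin H → Ω → ℝ
  policy : Fin K → Ω → Fin H → S → A
  priv : Fin K → Ω → Counts S A H

section Run

variable {Ω S A : Type*} {H K : ℕ}

/-- The action taken at step `h` of episode `k`. -/
def Run.action (R : Run Ω S A H K) (k : Fin K) (h : Fin H) (ω : Ω) : A :=
  R.policy k ω h (R.state k h.castSucc ω)

open Classical in
/-- The true (non-private) counts over the episodes before `k`. -/
noncomputable def Run.counts (R : Run Ω S A H K) (k : Fin K) (ω : Ω) : Counts S A H where
  C h s a := ∑ j ∈ Finset.Iio k,
    if R.state j h.castSucc ω = s ∧ R.action j h ω = a then R.cost j h ω else 0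
  N h s a := ∑ j ∈ Finset.Iio k,
    if R.state j h.castSucc ω = s ∧ R.action j h ω = a then 1 else 0
  N₃ h s a s' := ∑ j ∈ Finset.Iio k,
    if R.state j h.castSucc ω = s ∧ R.action j h ω = a ∧ R.state j h.succ ω = s' then 1 else 0

/-- All private counts are within the precision levels `E₁`, `E₂` of the true ones. -/
def Run.Accurate (R : Run Ω S A H K) (E₁ E₂ : ℝ) (ω : Ω) : Prop :=
  ∀ k h s a,
    |(R.priv k ω).N h s a - (R.counts k ω).N h s a| ≤ E₁ ∧
    |(R.priv k ω).C h s a - (R.counts k ω).C h s a| ≤ E₁ ∧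
    ∀ s', |(R.priv k ω).N₃ h s a s' - (R.counts k ω).N₃ h s a s'| ≤ E₂

variable [Fintype S] [Fintype A]

/-- The regret `∑_k (V_1^{π^k}(s_1^k) - V_1^*(s_1^k))`. -/
noncomputable def Run.regret (M : MDP S A H) (R : Run Ω S A H K) (s₁ : Fin K → S) (ω : Ω) : ℝ :=
  ∑ k, (M.value (Policy.deterministic (R.policy k ω)) (s₁ k) - M.optValue (s₁ k))

open Classical in
/-- `R` is an execution of the private optimistic value-iteration algorithm with confidence level
`δ` and precision levels `E₁`, `E₂`, on the MDP `M`, with initial states `s₁`.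

`ℱ t` is the information available after `t` steps of interaction with the environment; it contains
the internal randomness used so far by the privatizer and for breaking ties. The privatizer may be
any mechanism: before episode `k` it releases counts that depend only on the past trajectories and
on its internal randomness. -/
structure IsUCBVIRun [Nonempty A] {mΩ : MeasurableSpace Ω} (μ : Measure Ω)
    (ℱ : Filtration ℕ mΩ) (M : MDP S A H) (s₁ : Fin K → S) (δ E₁ E₂ : ℝ)
    (R : Run Ω S A H K) : Prop where
  -- what is known when
  state_meas : ∀ (k : Fin K) (h : Fin (H + 1)) (s : S),
      MeasurableSet[ℱ (k * H + h)] {ω | R.state k h ω = s}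
  cost_meas : ∀ (k : Fin K) (h : Fin H), Measurable[ℱ (k * H + h + 1)] (R.cost k h)
  policy_meas : ∀ (k : Fin K) (h : Fin H) (s : S) (a : A),
      MeasurableSet[ℱ (k * H)] {ω | R.policy k ω h s = a}
  priv_meas_C : ∀ (k : Fin K) (h : Fin H) (s : S) (a : A),
      Measurable[ℱ (k * H)] (fun ω => (R.priv k ω).C h s a)
  priv_meas_N : ∀ (k : Fin K) (h : Fin H) (s : S) (a : A),
      Measurable[ℱ (k * H)] (fun ω => (R.priv k ω).N h s a)
  priv_meas_N₃ : ∀ (k : Fin K) (h : Fin H) (s : S) (a : A) (s' : S),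
      Measurable[ℱ (k * H)] (fun ω => (R.priv k ω).N₃ h s a s')
  -- the environment
  state_init : ∀ k ω, R.state k 0 ω = s₁ k
  state_next : ∀ (k : Fin K) (h : Fin H) (s' : S),
      μ[(fun ω => if R.state k h.succ ω = s' then (1 : ℝ) else 0) | ℱ (k * H + h)] =ᵐ[μ]
      fun ω => M.P h (R.state k h.castSucc ω) (R.action k h ω) s'
  cost_mem : ∀ k h, ∀ᵐ ω ∂μ, R.cost k h ω ∈ Set.Icc (0 : ℝ) 1
  cost_mean : ∀ (k : Fin K) (h : Fin H), μ[R.cost k h | ℱ (k * H + h)] =ᵐ[μ]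
      fun ω => M.c h (R.state k h.castSucc ω) (R.action k h ω)
  -- the learner
  priv_init : ∀ k : Fin K, (k : ℕ) = 0 → ∀ ω,
      R.priv k ω = ⟨fun _ _ _ => 0, fun _ _ _ => 0, fun _ _ _ _ => 0⟩
  policy_greedy : ∀ k ω h s a,
      qTilde ⟨K, δ, E₁, E₂⟩ (R.priv k ω) h s (R.policy k ω h s) ≤
        qTilde ⟨K, δ, E₁, E₂⟩ (R.priv k ω) h s a

end Run

end PrivateRL

namespace PrivateRL

/-! ### Dynamic programming -/

section DynamicProgramming

variable {S A : Type*} [Fintype S]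

/-! The argument is optimism plus a one-step recursion for the gap between the value of the played
policy and its private estimate. Costs are minimised, so optimism means `vTilde ≤ optV`. On an event
where the true counts concentrate and the private counts are accurate, the denominator `D = denom`
satisfies `N ≤ D ≤ N + 1 + 2 E₁`, and the bonuses cover both the sampling error of the costs and of
the transitions against the fixed function `optV`, and the privacy noise. Backward induction gives
`vTilde_le_optV`, and the regret is at most the sum of the initial gaps.

In the recursion (`bellman_sub_qBackup_le`) the estimated transitions act on `optV`, handled as
above at scale `H` with no factor `√S`, and on `optV - vTilde`, which depends on the data. Since the
latter is nonnegative, a one-sided multiplicative Chernoff bound `N₃ ≤ (1 + 1/H) P N + H x`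
suffices: its relative error becomes a factor `1 + 1/H` on the expected next gap, and its additive
error is of order `S H² x / D`. Over `H` steps the factors multiply to at most `e`.

Replacing expected next gaps by realized ones costs a martingale term of order `H √(K x)` per step
(`gapDeviation_le`). The sums of `1/√N` and `1/N` along the visits are at most of order `√(S A K)`
and `S A log K` (`sum_inv_sqrt_visits_le`, `sum_inv_visits_le`). Over all steps the first
contributes `H² √(S A K) = √(S A H³ T)` up to logarithms, the second the lower-order terms
(`Run.regret_le`, `final_bound_le`).

All the concentration comes from one exponential supermartingale,
`Observations.integral_exp_le_one`. With `x = Lc²` every deviation event has probability of order `K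
e^{-x}` at most, so a union bound fits into `δ/2`; the privatizer uses the other `δ/2`. -/

theorem MDP.sum_P_mul_le {H : ℕ} (M : MDP S A H) (h : Fin H) (s : S) (a : A) {V : S → ℝ} {B : ℝ}
    (hV : ∀ s', V s' ≤ B) : ∑ s', M.P h s a s' * V s' ≤ B := by
  calc ∑ s', M.P h s a s' * V s' ≤ ∑ s', M.P h s a s' * B :=
        Finset.sum_le_sum fun s' _ => mul_le_mul_of_nonneg_left (hV s') (M.P_nonneg h s a s')
    _ = B := by rw [← Finset.sum_mul, M.P_sum, one_mul]

theorem MDP.sum_P_mul_mono {H : ℕ} (M : MDP S A H) (h : Fin H) (s : S) (a : A) {V W : S → ℝ}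
    (hV : ∀ s', V s' ≤ W s') : ∑ s', M.P h s a s' * V s' ≤ ∑ s', M.P h s a s' * W s' :=
  Finset.sum_le_sum fun s' _ => mul_le_mul_of_nonneg_left (hV s') (M.P_nonneg h s a s')

theorem MDP.sum_P_mul_nonneg {H : ℕ} (M : MDP S A H) (h : Fin H) (s : S) (a : A) {V : S → ℝ}
    (hV : ∀ s', 0 ≤ V s') : 0 ≤ ∑ s', M.P h s a s' * V s' :=
  Finset.sum_nonneg fun s' _ => mul_nonneg (M.P_nonneg h s a s') (hV s')

variable [Fintype A]

/-- The MDP that remains after the first step. -/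
def MDP.tail {H : ℕ} (M : MDP S A (H + 1)) : MDP S A H where
  P h := M.P h.succ
  c h := M.c h.succ
  P_nonneg h := M.P_nonneg h.succ
  P_sum h := M.P_sum h.succ
  c_nonneg h := M.c_nonneg h.succ
  c_le_one h := M.c_le_one h.succ

/-- The policy that remains after the first step. -/
def Policy.tail {H : ℕ} (π : Policy S A (H + 1)) : Policy S A H where
  prob h := π.prob h.succ
  prob_nonneg h := π.prob_nonneg h.succ
  prob_sum h := π.prob_sum h.succ

theorem sum_fin_cons {H : ℕ} {α : Type*} [Fintype α] (F : (Fin (H + 1) → α) → ℝ) :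
    ∑ x, F x = ∑ y, ∑ x : Fin H → α, F (Fin.cons y x) := by
  rw [← (Fin.consEquiv (fun _ : Fin (H + 1) => α)).sum_comp, Fintype.sum_prod_type]
  rfl

open Classical in
theorem MDP.trajProb_cons {H : ℕ} (M : MDP S A (H + 1)) (π : Policy S A (H + 1)) (s y : S)
    (x : Fin (H + 1) → S) (b : A) (a : Fin H → A) :
    M.trajProb π s (Fin.cons y x) (Fin.cons b a) =
      if y = s then π.prob 0 s b * ∑ s', M.P 0 s b s' * M.tail.trajProb π.tail s' x a else 0 := by
  unfold MDP.trajProb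
  rw [Fin.prod_univ_succ]
  by_cases h : y = s
  · subst h
    simp [MDP.tail, Policy.tail, mul_assoc]
  · simp [h]

/-- First-step analysis: condition on the first action and the next state. This turns the trajectory
definition of the value into the Bellman recursion. -/
theorem MDP.sum_trajProb_mul {H : ℕ} (M : MDP S A (H + 1)) (π : Policy S A (H + 1)) (s : S)
    (F : (Fin (H + 2) → S) → (Fin (H + 1) → A) → ℝ) :
    ∑ x, ∑ a, M.trajProb π s x a * F x a =
      ∑ b, π.prob 0 s b * ∑ s', M.P 0 s b s' *
        ∑ x, ∑ a, M.tail.trajProb π.tail s' x a * F (Fin.cons s x) (Fin.cons b a) := by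
  classical
  rw [sum_fin_cons]
  simp_rw [sum_fin_cons (α := A), MDP.trajProb_cons]
  rw [Finset.sum_eq_single s (by intro y _ hy; simp [hy]) (by simp)]
  simp only [if_true]
  rw [Finset.sum_comm]
  refine Finset.sum_congr rfl fun b _ => ?_
  simp only [Finset.mul_sum, Finset.sum_mul]
  rw [Finset.sum_congr rfl fun x _ => Finset.sum_comm]
  rw [Finset.sum_comm]
  refine Finset.sum_congr rfl fun _ _ => Finset.sum_congr rfl fun _ _ =>
    Finset.sum_congr rfl fun _ _ => ?_
  ring

theorem MDP.sum_trajProb {H : ℕ} (M : MDP S A H) (π : Policy S A H) (s : S) :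
    ∑ x, ∑ a, M.trajProb π s x a = 1 := by
  classical
  induction H generalizing s with
  | zero =>
    rw [sum_fin_cons]
    simp [MDP.trajProb]
  | succ H ih =>
    have := M.sum_trajProb_mul π s (fun _ _ => 1)
    simp only [mul_one, ih, M.P_sum, π.prob_sum] at this
    exact this

/-- A solution of the Bellman equations of a policy is its value. -/
theorem MDP.value_eq_of_bellman {H : ℕ} (M : MDP S A H) (π : Policy S A H)
    (U : Fin (H + 1) → S → ℝ) (hlast : ∀ s, U (Fin.last H) s = 0)
    (hU : ∀ h s, U h.castSucc s =
      ∑ a, π.prob h s a * (M.c h s a + ∑ s', M.P h s a s' * U h.succ s')) (s : S) :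
    M.value π s = U 0 s := by
  induction H generalizing s with
  | zero =>
    have := hlast s
    simp only [MDP.value, Finset.univ_eq_empty, Finset.sum_empty, mul_zero, Finset.sum_const_zero]
    exact this.symm
  | succ H ih =>
    have ih' := ih M.tail π.tail (fun h => U h.succ) hlast (fun h s => hU h.succ s)
    rw [MDP.value, M.sum_trajProb_mul, show U 0 s = _ from hU 0 s]
    refine Finset.sum_congr rfl fun b _ => ?_
    congr 1
    have key : ∀ s', ∑ x : Fin (H + 1) → S, ∑ a : Fin H → A, M.tail.trajProb π.tail s' x a *
        (∑ h : Fin (H + 1), M.c h ((Fin.cons s x : Fin (H + 2) → S) h.castSucc)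
          ((Fin.cons b a : Fin (H + 1) → A) h)) = M.c 0 s b + U 1 s' := by
      intro s'
      have h1 : U 1 s' = M.tail.value π.tail s' := (ih' s').symm
      rw [h1, MDP.value]
      have h2 : M.c 0 s b = ∑ x : Fin (H + 1) → S, ∑ a : Fin H → A,
          M.tail.trajProb π.tail s' x a * M.c 0 s b := by
        simp_rw [← Finset.sum_mul]
        rw [MDP.sum_trajProb, one_mul]
      rw [h2, ← Finset.sum_add_distrib]
      refine Finset.sum_congr rfl fun x _ => ?_
      rw [← Finset.sum_add_distrib]
      refine Finset.sum_congr rfl fun a _ => ?_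
      rw [Fin.sum_univ_succ, mul_add]
      rfl
    simp_rw [key, mul_add, Finset.sum_add_distrib]
    rw [← Finset.sum_mul, M.P_sum, one_mul]
    rfl

variable {H : ℕ}

/-- The value of a policy at each step, by backward recursion. -/
noncomputable def MDP.polV (M : MDP S A H) (π : Policy S A H) : Fin (H + 1) → S → ℝ :=
  Fin.reverseInduction (motive := fun _ => S → ℝ) (fun _ => 0)
    (fun h V s => ∑ a, π.prob h s a * (M.c h s a + ∑ s', M.P h s a s' * V s'))

theorem MDP.polV_last (M : MDP S A H) (π : Policy S A H) (s : S) :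
    M.polV π (Fin.last H) s = 0 := by
  simp [MDP.polV]

theorem MDP.polV_castSucc (M : MDP S A H) (π : Policy S A H) (h : Fin H) (s : S) :
    M.polV π h.castSucc s =
      ∑ a, π.prob h s a * (M.c h s a + ∑ s', M.P h s a s' * M.polV π h.succ s') := by
  simp [MDP.polV]

theorem MDP.value_eq_polV (M : MDP S A H) (π : Policy S A H) (s : S) :
    M.value π s = M.polV π 0 s :=
  M.value_eq_of_bellman π _ (M.polV_last π) (M.polV_castSucc π) s

theorem MDP.polV_deterministic (M : MDP S A H) (π : Fin H → S → A) (h : Fin H) (s : S) :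
    M.polV (Policy.deterministic π) h.castSucc s = M.c h s (π h s) +
      ∑ s', M.P h s (π h s) s' * M.polV (Policy.deterministic π) h.succ s' := by
  rw [MDP.polV_castSucc, Finset.sum_eq_single (π h s)]
  · simp [Policy.deterministic]
  · intro a _ ha
    simp [Policy.deterministic, ha.symm]
  · simp

/-- The optimal value at each step, by backward recursion. -/
noncomputable def MDP.optV [Nonempty A] (M : MDP S A H) : Fin (H + 1) → S → ℝ :=
  Fin.reverseInduction (motive := fun _ => S → ℝ) (fun _ => 0)
    (fun h V s => Finset.univ.inf' Finset.univ_nonempty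
      fun a => M.c h s a + ∑ s', M.P h s a s' * V s')

theorem MDP.optV_last [Nonempty A] (M : MDP S A H) (s : S) : M.optV (Fin.last H) s = 0 := by
  simp [MDP.optV]

theorem MDP.optV_castSucc [Nonempty A] (M : MDP S A H) (h : Fin H) (s : S) :
    M.optV h.castSucc s = Finset.univ.inf' Finset.univ_nonempty
      fun a => M.c h s a + ∑ s', M.P h s a s' * M.optV h.succ s' := by
  simp [MDP.optV]

theorem MDP.optV_nonneg [Nonempty A] (M : MDP S A H) (h : Fin (H + 1)) (s : S) :
    0 ≤ M.optV h s := by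
  induction h using Fin.reverseInduction generalizing s with
  | last => rw [MDP.optV_last]
  | cast h ih =>
    rw [MDP.optV_castSucc]
    exact Finset.le_inf' _ _ fun a _ =>
      add_nonneg (M.c_nonneg h s a) (M.sum_P_mul_nonneg h s a ih)

theorem MDP.optV_le_polV [Nonempty A] (M : MDP S A H) (π : Policy S A H) (h : Fin (H + 1))
    (s : S) : M.optV h s ≤ M.polV π h s := by
  induction h using Fin.reverseInduction generalizing s with
  | last => rw [MDP.optV_last, MDP.polV_last]
  | cast h ih =>
    rw [MDP.optV_castSucc, MDP.polV_castSucc]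
    calc _ = ∑ a, π.prob h s a * _ := by rw [← Finset.sum_mul, π.prob_sum, one_mul]
      _ ≤ _ := Finset.sum_le_sum fun a ha => mul_le_mul_of_nonneg_left
        ((Finset.inf'_le _ ha).trans (add_le_add_right (M.sum_P_mul_mono h s a ih) _))
        (π.prob_nonneg h s a)

theorem MDP.polV_nonneg [Nonempty A] (M : MDP S A H) (π : Policy S A H) (h : Fin (H + 1))
    (s : S) : 0 ≤ M.polV π h s :=
  (M.optV_nonneg h s).trans (M.optV_le_polV π h s)

theorem MDP.polV_le (M : MDP S A H) (π : Policy S A H) (h : Fin (H + 1))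
    (s : S) : M.polV π h s ≤ (H : ℝ) - (h : ℕ) := by
  induction h using Fin.reverseInduction generalizing s with
  | last => rw [MDP.polV_last]; simp
  | cast h ih =>
    rw [MDP.polV_castSucc]
    calc _ ≤ ∑ a, π.prob h s a * ((H : ℝ) - (h : ℕ)) := by
          refine Finset.sum_le_sum fun a ha => mul_le_mul_of_nonneg_left ?_ (π.prob_nonneg h s a)
          have h1 := M.sum_P_mul_le h s a ih
          have h2 := M.c_le_one h s a
          rw [Fin.val_succ] at h1
          push_cast at h1
          linarith
      _ = _ := by rw [← Finset.sum_mul, π.prob_sum, one_mul]; simp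

/-- Only this direction is needed: it carries the optimistic bound from `optV` over to the infimum
over policies, so attainment of the infimum plays no role. -/
theorem MDP.optV_zero_le_optValue [Nonempty A] (M : MDP S A H) (s : S) :
    M.optV 0 s ≤ M.optValue s := by
  have : Nonempty (Policy S A H) := ⟨Policy.deterministic fun _ _ => Classical.arbitrary A⟩
  exact le_ciInf fun π => (M.optV_le_polV π 0 s).trans (M.value_eq_polV π s).ge

theorem MDP.optV_le [Nonempty A] (M : MDP S A H) (h : Fin (H + 1)) (s : S) :
    M.optV h s ≤ (H : ℝ) - (h : ℕ) :=
  (M.optV_le_polV (Policy.deterministic fun _ _ => Classical.arbitrary A) h s).trans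
    (M.polV_le _ h s)

theorem vTilde_last [Nonempty A] (p : Params) (n : Counts S A H) (s : S) :
    vTilde p n (Fin.last H) s = 0 := by
  simp [vTilde]

theorem vTilde_castSucc [Nonempty A] (p : Params) (n : Counts S A H) (h : Fin H) (s : S) :
    vTilde p n h.castSucc s = Finset.univ.inf' Finset.univ_nonempty (qTilde p n h s) := by
  rw [vTilde, Fin.reverseInduction_castSucc]
  rfl

/-- The truncation enforces these bounds for arbitrary released counts, so they are available
outside the accuracy event too, as the martingale bound for the gaps requires. -/
theorem vTilde_mem [Nonempty A] (p : Params) (n : Counts S A H) (h : Fin (H + 1)) (s : S) :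
    0 ≤ vTilde p n h s ∧ vTilde p n h s ≤ (H : ℝ) - (h : ℕ) := by
  induction h using Fin.lastCases with
  | last => rw [vTilde_last]; simp
  | cast h =>
    rw [vTilde_castSucc]
    refine ⟨Finset.le_inf' _ _ fun a _ => le_min ?_ (le_max_left _ _),
      (Finset.inf'_le _ (Finset.mem_univ (Classical.arbitrary A))).trans (min_le_left _ _)⟩
    have : ((h : ℕ) : ℝ) ≤ H := by exact_mod_cast h.isLt.le
    linarith

theorem vTilde_le [Nonempty A] (p : Params) (n : Counts S A H) (h : Fin (H + 1)) (s : S) :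
    vTilde p n h s ≤ H :=
  (vTilde_mem p n h s).2.trans (sub_le_self _ (Nat.cast_nonneg _))

end DynamicProgramming


/-! ### Exponential inequalities for bounded martingale differences -/

section Concentration

/-- Hoeffding's lemma for a Bernoulli variable. -/
theorem one_add_mul_exp_sub_one_le {p : ℝ} (hp : p ∈ Set.Icc (0 : ℝ) 1) (u : ℝ) :
    1 + p * (Real.exp u - 1) ≤ Real.exp (u * p + u ^ 2 / 8) := by
  set ν : Measure ℝ := ENNReal.ofReal (1 - p) • Measure.dirac 0 + ENNReal.ofReal p • Measure.dirac 1
    with hν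
  have hp' : 0 ≤ 1 - p := by linarith [hp.2]
  have : IsProbabilityMeasure ν := ⟨by
    simp [hν, ← ENNReal.ofReal_add hp' hp.1]⟩
  have hint : ∀ f : ℝ → ℝ, ∫ x, f x ∂ν = (1 - p) * f 0 + p * f 1 := by
    intro f
    have h1 : Integrable f (ENNReal.ofReal (1 - p) • Measure.dirac (0 : ℝ)) :=
      (integrable_dirac (by simp)).smul_measure (by simp)
    have h2 : Integrable f (ENNReal.ofReal p • Measure.dirac (1 : ℝ)) :=
      (integrable_dirac (by simp)).smul_measure (by simp)
    rw [hν, integral_add_measure h1 h2]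
    simp [hp', hp.1]
  have hb : ∀ᵐ x ∂ν, id x ∈ Set.Icc (0 : ℝ) 1 := by
    rw [hν, ae_add_measure_iff]
    constructor
    · exact Measure.ae_smul_measure ((ae_dirac_iff measurableSet_Icc).2 (by simp)) _
    · exact Measure.ae_smul_measure ((ae_dirac_iff measurableSet_Icc).2 (by simp)) _
  have hs := (ProbabilityTheory.hasSubgaussianMGF_of_mem_Icc aemeasurable_id hb).mgf_le u
  rw [ProbabilityTheory.mgf, hint, hint] at hs
  simp at hs
  have h3 : Real.exp (u * p + u ^ 2 / 8) = Real.exp (u * p) * Real.exp (2⁻¹ ^ 2 * u ^ 2 / 2) := by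
    rw [← Real.exp_add]; congr 1; ring
  rw [h3]
  calc 1 + p * (Real.exp u - 1)
      = Real.exp (u * p) * ((1 - p) * Real.exp (-(u * p)) + p * Real.exp (u * (1 - p))) := by
        rw [mul_add, mul_left_comm, mul_left_comm (Real.exp (u * p)) p, ← Real.exp_add,
          ← Real.exp_add]
        rw [show u * p + -(u * p) = 0 by ring, show u * p + u * (1 - p) = u by ring, Real.exp_zero]
        ring
    _ ≤ _ := by rw [inv_pow]; exact mul_le_mul_of_nonneg_left hs (Real.exp_pos _).le

/-- The chord of a convex function lies above its graph. This reduces a `[0, 1]`-valued variable to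
a Bernoulli variable with the same mean. -/
theorem exp_mul_le_of_mem_Icc {x : ℝ} (hx : x ∈ Set.Icc (0 : ℝ) 1) (u : ℝ) :
    Real.exp (u * x) ≤ 1 + x * (Real.exp u - 1) := by
  have := convexOn_exp.2 (Set.mem_univ 0) (Set.mem_univ u) (sub_nonneg.2 hx.2) hx.1 (by ring)
  simp only [smul_eq_mul, mul_zero, zero_add, Real.exp_zero] at this
  rw [mul_comm u x]
  linarith

theorem measurable_indicator_of {Ω : Type*} {m : MeasurableSpace Ω} {f : Ω → ℝ}
    (hf : Measurable[m] f) {s : Set Ω} (hs : MeasurableSet[m] s) : Measurable[m] (s.indicator f) :=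
  hf.indicator hs

variable {Ω : Type*} {mΩ : MeasurableSpace Ω} {μ : Measure Ω} {K : ℕ}

theorem integral_mul_eq_of_condExp [IsProbabilityMeasure μ] {m : MeasurableSpace Ω}
    (hm : m ≤ mΩ) {X c G : Ω → ℝ}
    (hX : Integrable X μ) (hc : μ[X | m] =ᵐ[μ] c) (hG : Measurable[m] G)
    (hGX : Integrable (fun ω => G ω * X ω) μ) :
    ∫ ω, G ω * X ω ∂μ = ∫ ω, G ω * c ω ∂μ := by
  have h1 : μ[G * X | m] =ᵐ[μ] G * μ[X | m] :=
    condExp_mul_of_stronglyMeasurable_left hG.stronglyMeasurable hGX hX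
  rw [← integral_condExp hm (f := fun ω => G ω * X ω)]
  refine integral_congr_ae ?_
  filter_upwards [h1, hc] with ω h1 h2
  have : (μ[G * X | m]) ω = G ω * c ω := by rw [h1, Pi.mul_apply, h2]
  exact this

/-- A sequence of `[0, 1]`-valued variables `X j`, observed at times `j + 1`, with conditional
means `m j`; the observation is used when `I j` holds, which is known at time `j`. -/
structure Observations (μ : Measure Ω) (𝒢 : ℕ → MeasurableSpace Ω) (X m : Fin K → Ω → ℝ)
    (I : Fin K → Set Ω) : Prop where
  le : ∀ j, 𝒢 j ≤ mΩ
  mono : Monotone 𝒢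
  meas : ∀ j : Fin K, Measurable[𝒢 (j + 1)] (X j)
  mem : ∀ j, ∀ᵐ ω ∂μ, X j ω ∈ Set.Icc (0 : ℝ) 1
  mean_meas : ∀ j : Fin K, Measurable[𝒢 j] (m j)
  mean_mem : ∀ j ω, m j ω ∈ Set.Icc (0 : ℝ) 1
  mean : ∀ j : Fin K, μ[X j | 𝒢 j] =ᵐ[μ] m j
  set_meas : ∀ j : Fin K, MeasurableSet[𝒢 j] (I j)

variable {𝒢 : ℕ → MeasurableSpace Ω} {X m : Fin K → Ω → ℝ} {I : Fin K → Set Ω}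

/-- The indices before `n`. -/
def before (K n : ℕ) : Finset (Fin K) := Finset.univ.filter fun j => (j : ℕ) < n

theorem before_zero : before K 0 = ∅ := by simp [before]

theorem before_self : before K K = Finset.univ := by simp [before]

theorem before_val (k : Fin K) : before K k = Finset.Iio k := by
  ext j; simp [before]

theorem sum_before_succ {M : Type*} [AddCommMonoid M] (f : Fin K → M) (n : Fin K) :
    ∑ j ∈ before K (n + 1), f j = ∑ j ∈ before K n, f j + f n := by
  have : before K (n + 1) = insert n (before K n) := by
    ext j
    simp only [before, Finset.mem_filter, Finset.mem_univ, true_and, Finset.mem_insert, Fin.ext_iff]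
    omega
  rw [this, Finset.sum_insert (by simp [before]), add_comm]

theorem before_succ_of_le {n : ℕ} (hn : K ≤ n) : before K (n + 1) = before K n := by
  ext j
  have := j.isLt
  simp only [before, Finset.mem_filter, Finset.mem_univ, true_and]
  omega

/-- Increment of the log-Laplace process with parameters `u`, `α`, `β`. -/
noncomputable def increment (X m : Fin K → Ω → ℝ) (I : Fin K → Set Ω) (u α β : ℝ)
    (j : Fin K) : Ω → ℝ :=
  (I j).indicator fun ω => u * X j ω - (α * m j ω + β)

theorem Observations.increment_meas (hO : Observations μ 𝒢 X m I) (u α β : ℝ) (j : Fin K) :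
    Measurable[𝒢 (j + 1)] (increment X m I u α β j) := by
  have h1 : 𝒢 j ≤ 𝒢 (j + 1) := hO.mono (Nat.le_succ _)
  exact measurable_indicator_of
    (((hO.meas j).const_mul u).sub ((((hO.mean_meas j).mono h1 le_rfl).const_mul α).add_const β))
    (h1 _ (hO.set_meas j))

theorem Observations.abs_increment_le (hO : Observations μ 𝒢 X m I) (u α β : ℝ) (j : Fin K) :
    ∀ᵐ ω ∂μ, |increment X m I u α β j ω| ≤ |u| + |α| + |β| := by
  filter_upwards [hO.mem j] with ω hω
  unfold increment
  by_cases hI : ω ∈ I j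
  · rw [Set.indicator_of_mem hI]
    have hm := hO.mean_mem j ω
    have h1 : |u * X j ω| ≤ |u| := by
      rw [abs_mul, abs_of_nonneg hω.1]
      exact mul_le_of_le_one_right (abs_nonneg _) hω.2
    have h2 : |α * m j ω| ≤ |α| := by
      rw [abs_mul, abs_of_nonneg hm.1]
      exact mul_le_of_le_one_right (abs_nonneg _) hm.2
    calc _ ≤ |u * X j ω| + |α * m j ω + β| := abs_sub _ _
      _ ≤ |u * X j ω| + (|α * m j ω| + |β|) := by gcongr; exact abs_add_le _ _
      _ ≤ _ := by linarith
  · rw [Set.indicator_of_notMem hI, abs_zero]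
    positivity

theorem Observations.sum_increment_meas (hO : Observations μ 𝒢 X m I) (u α β : ℝ) (n : ℕ) :
    Measurable[𝒢 n] fun ω => ∑ j ∈ before K n, increment X m I u α β j ω := by
  refine Finset.measurable_fun_sum _ fun j hj => ?_
  exact (hO.increment_meas u α β j).mono (hO.mono (by simpa [before] using hj)) le_rfl

variable [IsProbabilityMeasure μ]

theorem Observations.integrable_exp (hO : Observations μ 𝒢 X m I) (u α β : ℝ) (n : ℕ) :
    Integrable (fun ω => Real.exp (∑ j ∈ before K n, increment X m I u α β j ω)) μ := by
  refine Integrable.of_bound (C := Real.exp (∑ j ∈ before K n, (|u| + |α| + |β|)))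
    ((Real.measurable_exp.comp
      ((hO.sum_increment_meas u α β n).mono (hO.le n) le_rfl)).aestronglyMeasurable) ?_
  filter_upwards [ae_all_iff.2 fun j => hO.abs_increment_le u α β j] with ω hω
  rw [Real.norm_eq_abs, abs_of_pos (Real.exp_pos _)]
  exact Real.exp_le_exp.2 (Finset.sum_le_sum fun j _ => (le_abs_self _).trans (hω j))

/-- The exponential process is a supermartingale: `hψ` bounds the conditional Laplace transform of
each increment. The chord bound makes each new factor affine in `X k`, so the conditional mean is
the only information about `X k` that enters. The choice `α = u`, `β = u²/8` gives Hoeffding, and `α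
= e^u - 1`, `β = 0` gives Chernoff. -/
theorem Observations.integral_exp_le_one (hO : Observations μ 𝒢 X m I) (u α β : ℝ)
    (hψ : ∀ p ∈ Set.Icc (0 : ℝ) 1, 1 + p * (Real.exp u - 1) ≤ Real.exp (α * p + β)) (n : ℕ) :
    ∫ ω, Real.exp (∑ j ∈ before K n, increment X m I u α β j ω) ∂μ ≤ 1 := by
  induction n with
  | zero => simp [before_zero]
  | succ n ih =>
    by_cases hn : K ≤ n
    · rwa [before_succ_of_le hn]
    obtain ⟨k, rfl⟩ : ∃ k : Fin K, (k : ℕ) = n := ⟨⟨n, by omega⟩, rfl⟩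
    simp_rw [sum_before_succ, Real.exp_add]
    set Z : Ω → ℝ := fun ω => Real.exp (∑ j ∈ before K k, increment X m I u α β j ω) with hZ
    have hZi : Integrable Z μ := hO.integrable_exp u α β k
    have hZm : Measurable[𝒢 k] Z := Real.measurable_exp.comp (hO.sum_increment_meas u α β k)
    set E : Ω → ℝ := fun ω => Real.exp (-(α * m k ω + β)) with hE
    have hEm : Measurable[𝒢 k] E :=
      Real.measurable_exp.comp (((hO.mean_meas k).const_mul α).add_const β).neg
    have hEb : ∀ ω, |E ω| ≤ Real.exp (|α| + |β|) := fun ω => by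
      rw [abs_of_pos (Real.exp_pos _)]
      refine Real.exp_le_exp.2 ?_
      have h2 : |α * m k ω| ≤ |α| := by
        rw [abs_mul, abs_of_nonneg (hO.mean_mem k ω).1]
        exact mul_le_of_le_one_right (abs_nonneg _) (hO.mean_mem k ω).2
      linarith [neg_le_abs (α * m k ω), neg_le_abs β]
    -- Coefficients, known at time `k`, with `exp (increment) ≤ a + b * X k`. Off `I k` the
    -- increment vanishes, hence `a = 1` and `b = 0` there.
    set a : Ω → ℝ := (I k).indicator E + (I k)ᶜ.indicator 1 with ha
    set b : Ω → ℝ := (I k).indicator fun ω => E ω * (Real.exp u - 1) with hb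
    have ham : Measurable[𝒢 k] a := by
      exact (measurable_indicator_of hEm (hO.set_meas k)).add
        (measurable_indicator_of (@measurable_const _ _ _ (𝒢 k) 1) (hO.set_meas k).compl)
    have hbm : Measurable[𝒢 k] b :=
      measurable_indicator_of (hEm.mul_const _) (hO.set_meas k)
    have hval : ∀ ω, (ω ∈ I k → a ω = E ω ∧ b ω = E ω * (Real.exp u - 1)) ∧
        (ω ∉ I k → a ω = 1 ∧ b ω = 0) := fun ω => by
      constructor <;> intro h <;> simp [ha, hb, h]
    have hab : ∀ ω, |a ω| ≤ Real.exp (|α| + |β|) ∧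
        |b ω| ≤ Real.exp (|α| + |β|) * |Real.exp u - 1| := fun ω => by
      by_cases h : ω ∈ I k
      · rw [((hval ω).1 h).1, ((hval ω).1 h).2, abs_mul]
        exact ⟨hEb ω, mul_le_mul_of_nonneg_right (hEb ω) (abs_nonneg _)⟩
      · rw [((hval ω).2 h).1, ((hval ω).2 h).2]
        simp only [abs_one, abs_zero]
        exact ⟨Real.one_le_exp (by positivity), by positivity⟩
    have hXm : Measurable (X k) := (hO.meas k).mono (hO.le _) le_rfl
    have hXi : Integrable (X k) μ := by
      refine Integrable.of_bound (C := 1) hXm.aestronglyMeasurable ?_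
      filter_upwards [hO.mem k] with ω hω
      rw [Real.norm_eq_abs, abs_of_nonneg hω.1]; exact hω.2
    have hZa : Integrable (fun ω => Z ω * a ω) μ :=
      hZi.mul_bdd (ham.mono (hO.le k) le_rfl).aestronglyMeasurable
        (Filter.Eventually.of_forall fun ω => (hab ω).1)
    have hZb : Integrable (fun ω => Z ω * b ω) μ :=
      hZi.mul_bdd (hbm.mono (hO.le k) le_rfl).aestronglyMeasurable
        (Filter.Eventually.of_forall fun ω => (hab ω).2)
    have hZbX : Integrable (fun ω => Z ω * b ω * X k ω) μ := by
      refine hZb.mul_bdd (c := 1) hXm.aestronglyMeasurable ?_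
      filter_upwards [hO.mem k] with ω hω
      rw [Real.norm_eq_abs, abs_of_nonneg hω.1]; exact hω.2
    have hZbm : Integrable (fun ω => Z ω * b ω * m k ω) μ := by
      refine hZb.mul_bdd (c := 1)
        ((hO.mean_meas k).mono (hO.le _) le_rfl).aestronglyMeasurable ?_
      refine Filter.Eventually.of_forall fun ω => ?_
      rw [Real.norm_eq_abs, abs_of_nonneg (hO.mean_mem k ω).1]; exact (hO.mean_mem k ω).2
    calc ∫ ω, Z ω * Real.exp (increment X m I u α β k ω) ∂μ
        ≤ ∫ ω, (Z ω * a ω + Z ω * b ω * X k ω) ∂μ := by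
          refine integral_mono_of_nonneg (Filter.Eventually.of_forall fun ω =>
            mul_nonneg (Real.exp_pos _).le (Real.exp_pos _).le) (hZa.add hZbX) ?_
          filter_upwards [hO.mem k] with ω hω
          rw [mul_assoc, ← mul_add]
          refine mul_le_mul_of_nonneg_left ?_ (Real.exp_pos _).le
          unfold increment
          by_cases h : ω ∈ I k
          · rw [((hval ω).1 h).1, ((hval ω).1 h).2, Set.indicator_of_mem h, sub_eq_add_neg,
              Real.exp_add]
            have h1 := exp_mul_le_of_mem_Icc hω u
            have h2 : 0 ≤ E ω := (Real.exp_pos _).le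
            calc _ = E ω * Real.exp (u * X k ω) := mul_comm _ _
              _ ≤ E ω * (1 + X k ω * (Real.exp u - 1)) := mul_le_mul_of_nonneg_left h1 h2
              _ = _ := by ring
          · rw [((hval ω).2 h).1, ((hval ω).2 h).2, Set.indicator_of_notMem h]
            simp
      _ = ∫ ω, Z ω * a ω ∂μ + ∫ ω, Z ω * b ω * X k ω ∂μ := integral_add hZa hZbX
      _ = ∫ ω, Z ω * a ω ∂μ + ∫ ω, Z ω * b ω * m k ω ∂μ := by
          rw [integral_mul_eq_of_condExp (G := fun ω => Z ω * b ω) (hO.le k) hXi (hO.mean k)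
            (hZm.mul hbm) hZbX]
      _ = ∫ ω, (Z ω * a ω + Z ω * b ω * m k ω) ∂μ := (integral_add hZa hZbm).symm
      _ ≤ ∫ ω, Z ω ∂μ := by
          refine integral_mono (hZa.add hZbm) hZi fun ω => ?_
          show Z ω * a ω + Z ω * b ω * m k ω ≤ Z ω
          rw [mul_assoc, ← mul_add]
          refine mul_le_of_le_one_right (Real.exp_pos _).le ?_
          by_cases h : ω ∈ I k
          · rw [((hval ω).1 h).1, ((hval ω).1 h).2]
            have h1 := hψ _ (hO.mean_mem k ω)
            have h2 : 0 ≤ E ω := (Real.exp_pos _).le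
            calc _ = E ω * (1 + m k ω * (Real.exp u - 1)) := by ring
              _ ≤ E ω * Real.exp (α * m k ω + β) := mul_le_mul_of_nonneg_left h1 h2
              _ = 1 := by rw [hE, ← Real.exp_add]; simp
          · rw [((hval ω).2 h).1, ((hval ω).2 h).2]
            simp
      _ ≤ 1 := ih

theorem Observations.tail_le (hO : Observations μ 𝒢 X m I) (u α β : ℝ)
    (hψ : ∀ p ∈ Set.Icc (0 : ℝ) 1, 1 + p * (Real.exp u - 1) ≤ Real.exp (α * p + β)) (n : ℕ)
    (x : ℝ) :
    μ.real {ω | x ≤ ∑ j ∈ before K n, increment X m I u α β j ω} ≤ Real.exp (-x) := by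
  have h := ProbabilityTheory.measure_ge_le_exp_mul_mgf (μ := μ)
    (X := fun ω => ∑ j ∈ before K n, increment X m I u α β j ω) x zero_le_one
    (by simpa using hO.integrable_exp u α β n)
  refine h.trans ?_
  have h1 := hO.integral_exp_le_one u α β hψ n
  unfold ProbabilityTheory.mgf
  simp only [one_mul, neg_mul]
  exact mul_le_of_le_one_right (Real.exp_pos _).le h1

/-- Multiplicative Chernoff bound. -/
theorem Observations.chernoff (hO : Observations μ 𝒢 X m I) (u : ℝ) (n : ℕ) (x : ℝ) :
    μ.real {ω | x ≤ ∑ j ∈ before K n,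
      (I j).indicator (fun ω => u * X j ω - (Real.exp u - 1) * m j ω) ω} ≤ Real.exp (-x) := by
  have := hO.tail_le u (Real.exp u - 1) 0 (fun p _ => by
    rw [add_zero, mul_comm, add_comm]; exact Real.add_one_le_exp _) n x
  simpa [increment] using this

/-- Self-normalized Hoeffding bound. -/
theorem Observations.deviation (hO : Observations μ 𝒢 X m I) (n : ℕ) {x : ℝ} (hx : 0 < x) :
    μ.real {ω | Real.sqrt ((∑ j ∈ before K n, (I j).indicator (fun _ => 1) ω) * x / 2) <
      |∑ j ∈ before K n, (I j).indicator (fun ω => X j ω - m j ω) ω|} ≤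
      2 * K * Real.exp (-x) := by
  classical
  -- The optimal Hoeffding parameter for `i` observations: `i u²/8 = x` and `u √(i x / 2) = 2 x`.
  -- The number of observations is random, so the union bound runs over its possible values `1, …,
  -- K` and over both signs, which gives the factor `2 K`.
  set u : ℕ → ℝ := fun i => Real.sqrt (8 * x / i) with hu
  let F : ℝ → Set Ω := fun v =>
    {ω | x ≤ ∑ j ∈ before K n, increment X m I v v (v ^ 2 / 8) j ω}
  have hF : ∀ v, μ.real (F v) ≤ Real.exp (-x) := fun v =>
    hO.tail_le v v (v ^ 2 / 8) (fun p hp => one_add_mul_exp_sub_one_le hp v) n x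
  have hsub : {ω | Real.sqrt ((∑ j ∈ before K n, (I j).indicator (fun _ => 1) ω) * x / 2) <
      |∑ j ∈ before K n, (I j).indicator (fun ω => X j ω - m j ω) ω|} ⊆
      ⋃ i ∈ Finset.Icc 1 K, (F (u i) ∪ F (-u i)) := by
    intro ω hω
    simp only [Set.mem_ofPred_eq] at hω
    set J := (before K n).filter fun j => ω ∈ I j with hJ
    have hcount : (∑ j ∈ before K n, (I j).indicator (fun _ => (1 : ℝ)) ω) = J.card := by
      simp [hJ, Set.indicator_apply]
    have hsum : (∑ j ∈ before K n, (I j).indicator (fun ω => X j ω - m j ω) ω) =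
        ∑ j ∈ J, (X j ω - m j ω) := by
      simp [hJ, Set.indicator_apply, Finset.sum_ite]
    rw [hcount, hsum] at hω
    -- With no observation both sides are `0` and the strict inequality fails, so the value `0`
    -- needs no event.
    have hpos : 0 < J.card := by
      rw [Nat.pos_iff_ne_zero]
      intro h0
      rw [Finset.card_eq_zero.1 h0] at hω
      simp at hω
    have hle : J.card ≤ K := by
      simpa using Finset.card_le_univ J
    have hcalc : ∀ v, (∑ j ∈ before K n, increment X m I v v (v ^ 2 / 8) j ω) =
        v * ∑ j ∈ J, (X j ω - m j ω) - J.card * (v ^ 2 / 8) := by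
      intro v
      simp only [increment, Set.indicator_apply, Finset.sum_ite, Finset.sum_const_zero, add_zero]
      rw [Finset.mul_sum, ← hJ, ← nsmul_eq_mul, ← Finset.sum_const, ← Finset.sum_sub_distrib]
      exact Finset.sum_congr rfl fun j _ => by ring
    have hJr : (0 : ℝ) < J.card := by exact_mod_cast hpos
    have hv2 : u J.card ^ 2 = 8 * x / J.card := Real.sq_sqrt (by positivity)
    have hv0 : 0 < u J.card := Real.sqrt_pos.2 (by positivity)
    have hprod : u J.card * Real.sqrt (J.card * x / 2) = 2 * x := by
      rw [hu, ← Real.sqrt_mul (by positivity),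
        show 8 * x / (J.card : ℝ) * (J.card * x / 2) = (2 * x) ^ 2 by field_simp; ring]
      exact Real.sqrt_sq (by positivity)
    have hsq : (J.card : ℝ) * (u J.card ^ 2 / 8) = x := by
      rw [hv2]; field_simp
    refine Set.mem_biUnion (x := J.card) (Finset.mem_coe.2 (Finset.mem_Icc.2 ⟨hpos, hle⟩)) ?_
    rcases lt_abs.1 hω with h | h
    · left
      show x ≤ _
      rw [hcalc, hsq]
      have := mul_le_mul_of_nonneg_left h.le hv0.le
      linarith
    · right
      show x ≤ _
      rw [hcalc, neg_sq, hsq]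
      have := mul_le_mul_of_nonneg_left h.le hv0.le
      linarith
  calc _ ≤ μ.real (⋃ i ∈ Finset.Icc 1 K, (F (u i) ∪ F (-u i))) :=
        measureReal_mono hsub (measure_ne_top _ _)
    _ ≤ ∑ i ∈ Finset.Icc 1 K, μ.real (F (u i) ∪ F (-u i)) := measureReal_biUnion_finset_le _ _
    _ ≤ ∑ i ∈ Finset.Icc 1 K, (Real.exp (-x) + Real.exp (-x)) :=
        Finset.sum_le_sum fun i _ => (measureReal_union_le _ _).trans (add_le_add (hF _) (hF _))
    _ = _ := by simp; ring

end Concentration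


/-! ### Optimism and the one-step regret inequality -/

section OneStep

variable {S A : Type*} {H : ℕ}

/-- The private counts `ñ` are within `E₁`, `E₂` of `n`. -/
def CloseTo (ñ n : Counts S A H) (E₁ E₂ : ℝ) : Prop :=
  ∀ h s a, |ñ.N h s a - n.N h s a| ≤ E₁ ∧ |ñ.C h s a - n.C h s a| ≤ E₁ ∧
    ∀ s', |ñ.N₃ h s a s' - n.N₃ h s a s'| ≤ E₂

variable {n ñ : Counts S A H} {p : Params} {x : ℝ}

theorem one_le_denom (p : Params) (ñ : Counts S A H) (h : Fin H) (s : S) (a : A) :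
    1 ≤ denom p ñ h s a := le_max_left _ _

/-- This is the purpose of the shift by `E₁`. Dividing by at least the true number of visits only
lowers nonnegative averages, which is the optimistic direction for costs. -/
theorem CloseTo.N_le_denom (hc : CloseTo ñ n p.E₁ p.E₂) (h : Fin H) (s : S) (a : A) :
    n.N h s a ≤ denom p ñ h s a := by
  refine le_trans ?_ (le_max_right _ _)
  have := (abs_le.1 (hc h s a).1).1
  linarith

theorem CloseTo.denom_le (hc : CloseTo ñ n p.E₁ p.E₂) (hE : 0 ≤ p.E₁) (h : Fin H) (s : S) (a : A)
    (hN : 0 ≤ n.N h s a) : denom p ñ h s a ≤ n.N h s a + (1 + 2 * p.E₁) := by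
  have := (abs_le.1 (hc h s a).1).2
  exact max_le (by linarith) (by linarith)

theorem sqrt_half_le {N D : ℝ} (hx : 0 ≤ x) (hN : 0 ≤ N) (hND : N ≤ D) :
    Real.sqrt (N * x / 2) ≤ Real.sqrt x * Real.sqrt D := by
  rw [← Real.sqrt_mul hx]
  apply Real.sqrt_le_sqrt
  nlinarith [mul_nonneg hN hx, mul_le_mul_of_nonneg_left hND hx]

variable [Fintype S]

/-- Numerator of the lower-order part of the one-step regret. -/
noncomputable def lowerOrder (S : Type*) [Fintype S] (H : ℕ) (p : Params) (x : ℝ) : ℝ :=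
  2 * H + 10 * H * p.E₁ + 3 * H * (Fintype.card S * p.E₂) + Fintype.card S * H ^ 2 * x

theorem lowerOrder_nonneg (hx : 0 ≤ x) (hE₁ : 0 ≤ p.E₁) (hE₂ : 0 ≤ p.E₂) :
    0 ≤ lowerOrder S H p x := by
  unfold lowerOrder; positivity

variable [Fintype A]

/-- Over the common denominator, comparisons with the Bellman operator become linear inequalities
between counts after multiplication by `denom`. -/
theorem backup_eq (hL : Lc S A H p = Real.sqrt x) (h : Fin H) (V : S → ℝ) (s : S) (a : A) :
    cTilde p ñ h s a + ∑ s', V s' * PTilde p ñ h s a s' -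
      (bonusC p ñ h s a + bonusPV p ñ h s a) =
    (ñ.C h s a + ∑ s', ñ.N₃ h s a s' * V s' -
      ((1 + H) * (Real.sqrt x * Real.sqrt (denom p ñ h s a)) +
        (3 * p.E₁ + H * (Fintype.card S * p.E₂ + 2 * p.E₁)))) / denom p ñ h s a := by
  have hD := one_le_denom p ñ h s a
  have hD0 : 0 < denom p ñ h s a := by linarith
  have h1 : Real.sqrt x / Real.sqrt (denom p ñ h s a) =
      Real.sqrt x * Real.sqrt (denom p ñ h s a) / denom p ñ h s a := by
    rw [mul_div_assoc, Real.sqrt_div_self']; ring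
  have h2 : ∑ s', V s' * PTilde p ñ h s a s' =
      (∑ s', ñ.N₃ h s a s' * V s') / denom p ñ h s a := by
    rw [Finset.sum_div]
    exact Finset.sum_congr rfl fun s' _ => by unfold PTilde; ring
  rw [h2, bonusC, bonusPV, hL, mul_div_assoc (H : ℝ), h1, cTilde]
  ring

variable [Nonempty A] {M : MDP S A H}

/-- The true counts concentrate around the parameters of `M`, at deviation level `x`. -/
structure Concentrated (M : MDP S A H) (n : Counts S A H) (x : ℝ) : Prop where
  N_nonneg : ∀ h s a, 0 ≤ n.N h s a
  cost : ∀ h s a, |n.C h s a - n.N h s a * M.c h s a| ≤ Real.sqrt (n.N h s a * x / 2)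
  opt : ∀ h s a, |∑ s', n.N₃ h s a s' * M.optV h.succ s' -
    n.N h s a * ∑ s', M.P h s a s' * M.optV h.succ s'| ≤ H * Real.sqrt (n.N h s a * x / 2)
  trans : ∀ h s a s', n.N₃ h s a s' ≤ (1 + 1 / (H : ℝ)) * M.P h s a s' * n.N h s a + H * x

/-- One step of optimism: the bonuses dominate the deviations of the costs and of the transitions
against `optV`, and the noise in the released counts. -/
theorem qBackup_le (hM : Concentrated M n x) (hc : CloseTo ñ n p.E₁ p.E₂)
    (hL : Lc S A H p = Real.sqrt x) (hx : 0 ≤ x) (hE₁ : 0 ≤ p.E₁) (hE₂ : 0 ≤ p.E₂) (h : Fin H)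
    {V : S → ℝ} (hV0 : ∀ s', 0 ≤ V s') (hVH : ∀ s', V s' ≤ H)
    (hV : ∀ s', V s' ≤ M.optV h.succ s') (hN₃ : ∀ s a s', 0 ≤ n.N₃ h s a s') (s : S) (a : A) :
    qBackup p ñ h V s a ≤ M.c h s a + ∑ s', M.P h s a s' * M.optV h.succ s' := by
  have hPV := M.sum_P_mul_nonneg h s a fun s' => M.optV_nonneg h.succ s'
  have hc0 := M.c_nonneg h s a
  refine (min_le_right _ _).trans (max_le (add_nonneg hc0 hPV) ?_)
  rw [backup_eq hL]
  have hD := one_le_denom p ñ h s a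
  rw [div_le_iff₀ (by linarith)]
  have hN := hM.N_nonneg h s a
  have hND := hc.N_le_denom h s a
  have hsq := sqrt_half_le hx hN hND
  have h1 := (abs_le.1 (hM.cost h s a)).2
  have h2 := (abs_le.1 (hM.opt h s a)).2
  have h3 := (abs_le.1 (hc h s a).2.1).2
  -- Private counts may be negative, so `V ≤ optV` cannot be used against them directly. First pass
  -- to the true counts at cost `E₂ * V s' ≤ E₂ * H`, then use monotonicity.
  have h4 : ∑ s', ñ.N₃ h s a s' * V s' ≤
      ∑ s', n.N₃ h s a s' * M.optV h.succ s' + Fintype.card S * p.E₂ * H := by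
    calc _ ≤ ∑ s', (n.N₃ h s a s' * M.optV h.succ s' + p.E₂ * H) := by
          refine Finset.sum_le_sum fun s' _ => ?_
          have h5 := (abs_le.1 ((hc h s a).2.2 s')).2
          have h6 := mul_le_mul_of_nonneg_right (sub_le_iff_le_add.1 h5) (hV0 s')
          have h7 := mul_le_mul_of_nonneg_left (hV s') (hN₃ s a s')
          have h8 := mul_le_mul_of_nonneg_left (hVH s') hE₂
          linarith
      _ = _ := by rw [Finset.sum_add_distrib]; simp; ring
  have h5 := mul_le_mul_of_nonneg_left hsq (Nat.cast_nonneg (α := ℝ) H)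
  have h6 := mul_le_mul_of_nonneg_right hND hc0
  have h7 := mul_le_mul_of_nonneg_right hND hPV
  have h8 := mul_nonneg (Nat.cast_nonneg (α := ℝ) H) hE₁
  linarith

theorem vTilde_le_optV (hM : Concentrated M n x) (hc : CloseTo ñ n p.E₁ p.E₂)
    (hL : Lc S A H p = Real.sqrt x) (hx : 0 ≤ x) (hE₁ : 0 ≤ p.E₁) (hE₂ : 0 ≤ p.E₂)
    (hN₃ : ∀ h s a s', 0 ≤ n.N₃ h s a s') (h : Fin (H + 1)) (s : S) :
    vTilde p ñ h s ≤ M.optV h s := by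
  induction h using Fin.reverseInduction generalizing s with
  | last => rw [vTilde_last, MDP.optV_last]
  | cast h ih =>
    rw [vTilde_castSucc, MDP.optV_castSucc]
    refine Finset.le_inf' _ _ fun a ha => (Finset.inf'_le _ ha).trans ?_
    exact qBackup_le hM hc hL hx hE₁ hE₂ h (fun s' => (vTilde_mem p ñ _ s').1)
      (vTilde_le p ñ _) ih (hN₃ h) s a

/-- Split `V = optV - (optV - V)` under the estimated transitions. The first part concentrates
because `optV` is deterministic; the second is nonnegative, so the one-sided bound `hM.trans`
controls it uniformly in `V`. Finally `optV ≤ U` turns its relative error into a multiple of the gap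
`U - V`. -/
theorem bellman_sub_qBackup_le (hM : Concentrated M n x) (hc : CloseTo ñ n p.E₁ p.E₂)
    (hL : Lc S A H p = Real.sqrt x) (hx : 0 ≤ x) (hE₁ : 0 ≤ p.E₁) (hE₂ : 0 ≤ p.E₂) (h : Fin H)
    {U V : S → ℝ} (hV0 : ∀ s', 0 ≤ V s')
    (hV : ∀ s', V s' ≤ M.optV h.succ s') (hU : ∀ s', M.optV h.succ s' ≤ U s') (s : S) (a : A)
    (hUH : M.c h s a + ∑ s', M.P h s a s' * U s' ≤ (H : ℝ) - (h : ℕ)) :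
    M.c h s a + ∑ s', M.P h s a s' * U s' - qBackup p ñ h V s a ≤
      (1 + 1 / (H : ℝ)) * ∑ s', M.P h s a s' * (U s' - V s') +
        (4 * H * Real.sqrt x / Real.sqrt (denom p ñ h s a) +
          lowerOrder S H p x / denom p ñ h s a) := by
  have hH : (1 : ℝ) ≤ H := by exact_mod_cast (Nat.pos_of_ne_zero fun h0 => by
    subst h0; exact h.elim0)
  have hD := one_le_denom p ñ h s a
  set D := denom p ñ h s a with hDdef
  have hD0 : 0 < D := by linarith
  have hPUV := M.sum_P_mul_nonneg h s a fun s' => sub_nonneg.2 ((hV s').trans (hU s'))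
  have hlow := lowerOrder_nonneg (S := S) (H := H) hx hE₁ hE₂
  have hrhs : 0 ≤ (1 + 1 / (H : ℝ)) * ∑ s', M.P h s a s' * (U s' - V s') +
        (4 * H * Real.sqrt x / Real.sqrt D + lowerOrder S H p x / D) := by positivity
  rw [qBackup, sub_le_comm]
  -- Truncation from above is harmless because the Bellman value is at most `H - h` by `hUH` and the
  -- error terms are nonnegative; truncation at `0` only raises the estimate.
  refine le_min (by linarith) ((?_ : _ ≤ _).trans (le_max_right _ _))
  rw [backup_eq hL, ← hDdef, le_div_iff₀ hD0]
  have hN := hM.N_nonneg h s a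
  have hND : n.N h s a ≤ D := hc.N_le_denom h s a
  have hDN : D ≤ n.N h s a + (1 + 2 * p.E₁) := hc.denom_le hE₁ h s a hN
  have hsq := sqrt_half_le hx hN hND
  have h1 := (abs_le.1 (hM.cost h s a)).1
  have h2 := (abs_le.1 (hM.opt h s a)).1
  have h3 := (abs_le.1 (hc h s a).2.1).1
  have hPopt := M.sum_P_mul_nonneg h s a fun s' => M.optV_nonneg h.succ s'
  have hPoptH : ∑ s', M.P h s a s' * M.optV h.succ s' ≤ H := M.sum_P_mul_le h s a fun s' =>
    (M.optV_le h.succ s').trans (sub_le_self _ (Nat.cast_nonneg _))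
  have hoptH : ∀ s', M.optV h.succ s' ≤ H := fun s' =>
    (M.optV_le h.succ s').trans (sub_le_self _ (Nat.cast_nonneg _))
  -- the estimated transitions against `optV`
  have h4 : ∑ s', n.N₃ h s a s' * M.optV h.succ s' - Fintype.card S * p.E₂ * H ≤
      ∑ s', ñ.N₃ h s a s' * M.optV h.succ s' := by
    rw [sub_le_iff_le_add]
    calc _ ≤ ∑ s', (ñ.N₃ h s a s' * M.optV h.succ s' + p.E₂ * H) := by
          refine Finset.sum_le_sum fun s' _ => ?_
          have h5 := (abs_le.1 ((hc h s a).2.2 s')).1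
          have h6 := mul_le_mul_of_nonneg_right h5 (M.optV_nonneg h.succ s')
          have h8 := mul_le_mul_of_nonneg_left (hoptH s') hE₂
          linarith
      _ = _ := by rw [Finset.sum_add_distrib]; simp; ring
  -- the estimated transitions against `optV - V`
  have h5 : ∑ s', (ñ.N₃ h s a s' - D * M.P h s a s') * (M.optV h.succ s' - V s') ≤
      D * (1 / (H : ℝ) * ∑ s', M.P h s a s' * (M.optV h.succ s' - V s')) +
        Fintype.card S * (H * (p.E₂ + H * x)) := by
    calc _ ≤ ∑ s', (D * (1 / (H : ℝ)) * (M.P h s a s' * (M.optV h.succ s' - V s')) +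
          H * (p.E₂ + H * x)) := by
          refine Finset.sum_le_sum fun s' _ => ?_
          have h6 := (abs_le.1 ((hc h s a).2.2 s')).2
          have h7 := hM.trans h s a s'
          have h8 : (1 + 1 / (H : ℝ)) * M.P h s a s' * n.N h s a ≤
              (1 + 1 / (H : ℝ)) * M.P h s a s' * D :=
            mul_le_mul_of_nonneg_left hND (mul_nonneg (by positivity) (M.P_nonneg h s a s'))
          have h9 : ñ.N₃ h s a s' - D * M.P h s a s' ≤
              D * (1 / (H : ℝ)) * M.P h s a s' + (p.E₂ + H * x) := by linarith
          have h10 := mul_le_mul_of_nonneg_right h9 (sub_nonneg.2 (hV s'))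
          have h11 : M.optV h.succ s' - V s' ≤ H := by linarith [hoptH s', hV0 s']
          have h12 := mul_le_mul_of_nonneg_left h11 (show 0 ≤ p.E₂ + H * x by positivity)
          linarith
      _ = _ := by rw [Finset.sum_add_distrib, ← Finset.mul_sum]; simp; ring
  have h6 : ∑ s', (ñ.N₃ h s a s' - D * M.P h s a s') * (M.optV h.succ s' - V s') =
      ∑ s', ñ.N₃ h s a s' * M.optV h.succ s' - ∑ s', ñ.N₃ h s a s' * V s' -
        D * ∑ s', M.P h s a s' * M.optV h.succ s' + D * ∑ s', M.P h s a s' * V s' := by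
    rw [Finset.mul_sum, Finset.mul_sum, ← Finset.sum_sub_distrib, ← Finset.sum_sub_distrib,
      ← Finset.sum_add_distrib]
    exact Finset.sum_congr rfl fun s' _ => by ring
  have h7 : 1 / (H : ℝ) * ∑ s', M.P h s a s' * (M.optV h.succ s' - V s') ≤
      1 / (H : ℝ) * ∑ s', M.P h s a s' * (U s' - V s') :=
    mul_le_mul_of_nonneg_left (M.sum_P_mul_mono h s a fun s' => sub_le_sub_right (hU s') _)
      (by positivity)
  have h7' := mul_le_mul_of_nonneg_left h7 hD0.le
  have h8 : ∑ s', M.P h s a s' * (U s' - V s') =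
      ∑ s', M.P h s a s' * U s' - ∑ s', M.P h s a s' * V s' := by
    rw [← Finset.sum_sub_distrib]; exact Finset.sum_congr rfl fun s' _ => by ring
  have h9 : Real.sqrt x / Real.sqrt D * D = Real.sqrt x * Real.sqrt D := by
    rw [div_mul_eq_mul_div, mul_div_assoc, Real.div_sqrt]
  have hLD : 0 ≤ Real.sqrt x * Real.sqrt D := by positivity
  have h10 := mul_le_mul_of_nonneg_left hsq (Nat.cast_nonneg (α := ℝ) H)
  -- `D c ≤ N c + (1 + 2 E₁)` and similarly for `optV`
  have h11 : D * M.c h s a ≤ n.N h s a * M.c h s a + (1 + 2 * p.E₁) := by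
    have := mul_le_mul_of_nonneg_right hDN (M.c_nonneg h s a)
    have := mul_le_mul_of_nonneg_left (M.c_le_one h s a) (show 0 ≤ 1 + 2 * p.E₁ by linarith)
    linarith
  have h12 : D * ∑ s', M.P h s a s' * M.optV h.succ s' ≤
      n.N h s a * (∑ s', M.P h s a s' * M.optV h.succ s') + (1 + 2 * p.E₁) * H := by
    have := mul_le_mul_of_nonneg_right hDN hPopt
    have := mul_le_mul_of_nonneg_left hPoptH (show 0 ≤ 1 + 2 * p.E₁ by linarith)
    linarith
  have h13 : Real.sqrt x * Real.sqrt D ≤ H * (Real.sqrt x * Real.sqrt D) :=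
    le_mul_of_one_le_left hLD hH
  have h14 : p.E₁ ≤ H * p.E₁ := le_mul_of_one_le_left hE₁ hH
  have h15 : (4 * H * Real.sqrt x / Real.sqrt D + lowerOrder S H p x / D) * D =
      4 * (H * (Real.sqrt x * Real.sqrt D)) + lowerOrder S H p x := by
    rw [← h9]; field_simp
  rw [h8] at h7' ⊢
  have h16 : (M.c h s a + ∑ s', M.P h s a s' * U s' -
      ((1 + 1 / (H : ℝ)) * (∑ s', M.P h s a s' * U s' - ∑ s', M.P h s a s' * V s') +
        (4 * H * Real.sqrt x / Real.sqrt D + lowerOrder S H p x / D))) * D =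
      D * M.c h s a + D * (∑ s', M.P h s a s' * V s') - D * (1 / (H : ℝ) *
        (∑ s', M.P h s a s' * U s' - ∑ s', M.P h s a s' * V s')) -
        (4 * (H * (Real.sqrt x * Real.sqrt D)) + lowerOrder S H p x) := by
    rw [← h15]; ring
  rw [h16]
  -- Tally: bonuses and deviations contribute `2 + 2 H ≤ 4 H` times `√x √D`. The `10 H E₁` is `4`
  -- from `D - N`, `1` from the cost noise and `5` from the bonuses. The three `H S E₂` come from
  -- the bonus, `h4` and `h5`; `S H² x` is the additive Chernoff error.
  unfold lowerOrder
  linarith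

end OneStep

/-! ### Sums of bonuses over the visits -/

section Pigeonhole

open Classical in
-- Group the indices by the visited point. Successive visits to `b` see `0, 1, 2, …` earlier visits,
-- so the sum over them telescopes against the potential `G`.
theorem sum_visits_le {K : ℕ} {β : Type*} [Fintype β] (y : Fin K → β) (g G : ℕ → ℝ)
    (hG : ∀ i, g i ≤ G (i + 1) - G i) :
    ∑ k, g (((Finset.Iio k).filter fun j => y j = y k).card) ≤
      ∑ b, (G ((Finset.univ.filter fun j => y j = b).card) - G 0) := by
  have key : ∀ b, ∀ i : ℕ, ∑ k ∈ before K i,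
      (if y k = b then g (((Finset.Iio k).filter fun j => y j = b).card) else 0) ≤
      G (((before K i).filter fun j => y j = b).card) - G 0 := by
    intro b i
    induction i with
    | zero => simp [before_zero]
    | succ i ih =>
      by_cases hi : K ≤ i
      · rwa [before_succ_of_le hi]
      obtain ⟨k, rfl⟩ : ∃ k : Fin K, (k : ℕ) = i := ⟨⟨i, by omega⟩, rfl⟩
      have hcard : ((before K (k + 1)).filter fun j => y j = b).card =
          ((Finset.Iio k).filter fun j => y j = b).card + if y k = b then 1 else 0 := by
        rw [Finset.card_filter, sum_before_succ, before_val, ← Finset.card_filter]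
      rw [sum_before_succ, hcard, before_val]
      rw [before_val] at ih
      split_ifs with hb
      · linarith [hG (((Finset.Iio k).filter fun j => y j = b).card)]
      · simpa using ih
  calc _ = ∑ k, ∑ b, (if y k = b then g (((Finset.Iio k).filter fun j => y j = b).card)
          else 0) := by simp
    _ = ∑ b, ∑ k, (if y k = b then g (((Finset.Iio k).filter fun j => y j = b).card)
          else 0) := Finset.sum_comm
    _ ≤ _ := Finset.sum_le_sum fun b _ => by simpa [before_self] using key b K

theorem inv_sqrt_max_le (i : ℕ) : 1 / Real.sqrt (max 1 (i : ℝ)) ≤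
    3 * Real.sqrt ((i + 1 : ℕ) : ℝ) - 3 * Real.sqrt (i : ℝ) := by
  rcases Nat.eq_zero_or_pos i with rfl | hi
  · norm_num
  have hi1 : (1 : ℝ) ≤ i := by exact_mod_cast hi
  rw [max_eq_right hi1, div_le_iff₀ (Real.sqrt_pos.2 (by linarith))]
  set a := Real.sqrt (i : ℝ)
  set b := Real.sqrt ((i + 1 : ℕ) : ℝ)
  have ha : a ^ 2 = i := Real.sq_sqrt (by linarith)
  have hb : b ^ 2 = i + 1 := by rw [Real.sq_sqrt (by positivity)]; push_cast; ring
  have ha0 : 0 ≤ a := Real.sqrt_nonneg _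
  have hb0 : 0 ≤ b := Real.sqrt_nonneg _
  -- As `b - a = 1 / (a + b)` and `a + b ≤ 3 a`, the increment `3 (b - a)` is at least `1 / a`:
  -- hence the constant `3`.
  have hba : b ≤ 2 * a := by
    refine abs_le_of_sq_le_sq' ?_ (by linarith) |>.2
    nlinarith
  have hab : a ≤ b := Real.sqrt_le_sqrt (by push_cast; linarith)
  nlinarith

theorem inv_max_le (i : ℕ) : 1 / max 1 (i : ℝ) ≤
    3 * Real.log (((i + 1 : ℕ) : ℝ) + 1) - 3 * Real.log ((i : ℝ) + 1) := by
  have h1 : 1 / ((i : ℝ) + 2) ≤ Real.log (((i + 1 : ℕ) : ℝ) + 1) - Real.log ((i : ℝ) + 1) := by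
    rw [← Real.log_div (by positivity) (by positivity)]
    refine le_trans ?_ (Real.one_sub_inv_le_log_of_pos (by positivity))
    push_cast
    apply le_of_eq
    field_simp
    ring
  have h2 : 1 / max 1 (i : ℝ) ≤ 3 * (1 / ((i : ℝ) + 2)) := by
    rw [mul_one_div, div_le_div_iff₀ (by positivity) (by positivity)]
    have := le_max_left 1 (i : ℝ)
    have := le_max_right 1 (i : ℝ)
    linarith
  linarith

open Classical in
theorem sum_inv_sqrt_visits_le {K : ℕ} {β : Type*} [Fintype β] (y : Fin K → β) :
    ∑ k, 1 / Real.sqrt (max 1 (((Finset.Iio k).filter fun j => y j = y k).card : ℝ)) ≤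
      3 * Real.sqrt (Fintype.card β * K) := by
  refine (sum_visits_le y (fun i => 1 / Real.sqrt (max 1 (i : ℝ))) (fun i => 3 * Real.sqrt i)
    inv_sqrt_max_le).trans ?_
  simp only [Nat.cast_zero, Real.sqrt_zero, mul_zero, sub_zero]
  rw [← Finset.mul_sum]
  refine mul_le_mul_of_nonneg_left ?_ (by norm_num)
  -- Cauchy–Schwarz over the points; the visit counts add up to `K`.
  refine Real.le_sqrt_of_sq_le (sq_sum_le_card_mul_sum_sq.trans ?_)
  rw [Finset.card_univ]
  refine mul_le_mul_of_nonneg_left (le_of_eq ?_) (by positivity)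
  simp_rw [Real.sq_sqrt (Nat.cast_nonneg _)]
  rw [← Nat.cast_sum]
  congr 1
  have := Finset.card_eq_sum_card_fiberwise (f := y) (s := Finset.univ) (t := Finset.univ)
    (by simp)
  simpa using this.symm

open Classical in
theorem sum_inv_visits_le {K : ℕ} {β : Type*} [Fintype β] (y : Fin K → β) :
    ∑ k, 1 / max 1 (((Finset.Iio k).filter fun j => y j = y k).card : ℝ) ≤
      3 * Fintype.card β * Real.log (K + 1) := by
  refine (sum_visits_le y (fun i => 1 / max 1 (i : ℝ)) (fun i => 3 * Real.log ((i : ℝ) + 1))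
    inv_max_le).trans ?_
  calc _ ≤ ∑ b : β, 3 * Real.log ((K : ℝ) + 1) := by
        refine Finset.sum_le_sum fun b _ => ?_
        simp only [Nat.cast_zero, zero_add, Real.log_one, mul_zero, sub_zero]
        refine mul_le_mul_of_nonneg_left (Real.log_le_log (by positivity) ?_) (by norm_num)
        have : (Finset.univ.filter fun j => y j = b).card ≤ K := by
          simpa using Finset.card_le_univ (Finset.univ.filter fun j => y j = b)
        have : ((Finset.univ.filter fun j => y j = b).card : ℝ) ≤ K := by exact_mod_cast this
        linarith
    _ = _ := by simp; ring

end Pigeonhole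


/-! ### Regret of a run whose counts concentrate -/

section Pathwise

variable {Ω S A : Type*} {H K : ℕ}

theorem one_add_inv_pow_le (H : ℕ) : (1 + 1 / (H : ℝ)) ^ H ≤ 3 := by
  rcases Nat.eq_zero_or_pos H with rfl | hH
  · norm_num
  have hH' : (H : ℝ) ≠ 0 := by exact_mod_cast hH.ne'
  calc (1 + 1 / (H : ℝ)) ^ H ≤ Real.exp (1 / H) ^ H := by
        gcongr
        rw [add_comm]
        exact Real.add_one_le_exp _
    _ = Real.exp 1 := by rw [← Real.exp_nat_mul, mul_one_div_cancel hH']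
    _ ≤ 3 := by linarith [Real.exp_one_lt_d9]

/-- Discrete Gronwall inequality over the steps of an episode. -/
theorem le_of_step_le {D : Fin (H + 1) → ℝ} {Y : ℝ} (hY : 0 ≤ Y) (hlast : D (Fin.last H) = 0)
    (hD : ∀ h : Fin H, D h.castSucc ≤ (1 + 1 / (H : ℝ)) * (D h.succ + Y)) : D 0 ≤ 3 * H * Y := by
  have key : ∀ h : Fin (H + 1),
      D h ≤ (1 + 1 / (H : ℝ)) ^ (H - (h : ℕ)) * (((H : ℝ) - (h : ℕ)) * Y) := by
    intro h
    induction h using Fin.reverseInduction with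
    | last => simp [hlast]
    | cast h ih =>
      have hγ : (1 : ℝ) ≤ 1 + 1 / (H : ℝ) := by
        have : 0 ≤ 1 / (H : ℝ) := by positivity
        linarith
      have hh := h.isLt
      obtain ⟨r, hr⟩ : ∃ r, H - (h.castSucc : ℕ) = r + 1 := ⟨H - h - 1, by simp; omega⟩
      have hr' : H - (h.succ : ℕ) = r := by simp at hr ⊢; omega
      rw [hr'] at ih
      rw [hr, pow_succ', mul_assoc]
      refine (hD h).trans (mul_le_mul_of_nonneg_left ?_ (by linarith))
      have h1 : Y ≤ (1 + 1 / (H : ℝ)) ^ r * Y := le_mul_of_one_le_left hY (one_le_pow₀ hγ)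
      rw [Fin.val_succ] at ih
      push_cast at ih
      rw [Fin.val_castSucc]
      linarith
  have h0 := key 0
  simp only [Fin.val_zero, Nat.cast_zero, sub_zero, Nat.sub_zero] at h0
  refine h0.trans ?_
  rw [mul_assoc]
  exact mul_le_mul_of_nonneg_right (one_add_inv_pow_le H) (by positivity)

theorem Run.counts_N₃_nonneg (R : Run Ω S A H K) (k : Fin K) (ω : Ω) (h : Fin H) (s : S) (a : A)
    (s' : S) : 0 ≤ (R.counts k ω).N₃ h s a s' :=
  Finset.sum_nonneg fun _ _ => by split_ifs <;> norm_num

open Classical in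
theorem Run.counts_N_eq_card (R : Run Ω S A H K) (k : Fin K) (ω : Ω) (h : Fin H) (s : S) (a : A) :
    (R.counts k ω).N h s a = (((Finset.Iio k).filter fun j =>
      (R.state j h.castSucc ω, R.action j h ω) = (s, a)).card : ℝ) := by
  simp [Run.counts, Finset.sum_boole]

variable [Fintype S] [Fintype A] [Nonempty A]

/-- Gap between the value of the policy of episode `k` and its estimate. -/
noncomputable def Run.gap (M : MDP S A H) (R : Run Ω S A H K) (p : Params) (k : Fin K)
    (h : Fin (H + 1)) (s : S) (ω : Ω) : ℝ :=
  M.polV (Policy.deterministic (R.policy k ω)) h s - vTilde p (R.priv k ω) h s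

theorem Run.abs_gap_le (M : MDP S A H) (R : Run Ω S A H K) (p : Params) (k : Fin K)
    (h : Fin (H + 1)) (s : S) (ω : Ω) : |R.gap M p k h s ω| ≤ H := by
  have h1 := M.polV_nonneg (Policy.deterministic (R.policy k ω)) h s
  have h2 := M.polV_le (Policy.deterministic (R.policy k ω)) h s
  have h3 := vTilde_mem p (R.priv k ω) h s
  have h4 := vTilde_le p (R.priv k ω) h s
  have h5 : (0 : ℝ) ≤ (h : ℕ) := Nat.cast_nonneg _
  unfold Run.gap
  rw [abs_le]
  constructor <;> linarith

variable {M : MDP S A H} {R : Run Ω S A H K} {p : Params} {x : ℝ} {ω : Ω}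

/-- Greediness identifies the estimate at the played action with `vTilde`. The private denominator
is then replaced by the smaller `max 1 N`, so that the pigeonhole sums involve true visits only. -/
theorem Run.gap_step (hL : Lc S A H p = Real.sqrt x) (hx : 0 ≤ x) (hE₁ : 0 ≤ p.E₁)
    (hE₂ : 0 ≤ p.E₂) (k : Fin K)
    (hgreedy : ∀ h s a, qTilde p (R.priv k ω) h s (R.policy k ω h s) ≤
      qTilde p (R.priv k ω) h s a)
    (hacc : CloseTo (R.priv k ω) (R.counts k ω) p.E₁ p.E₂)
    (hconc : Concentrated M (R.counts k ω) x) (h : Fin H) (s : S) :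
    R.gap M p k h.castSucc s ω ≤
      (1 + 1 / (H : ℝ)) * ∑ s', M.P h s (R.policy k ω h s) s' * R.gap M p k h.succ s' ω +
        (4 * H * Real.sqrt x * (1 / Real.sqrt (max 1 ((R.counts k ω).N h s (R.policy k ω h s)))) +
          lowerOrder S H p x * (1 / max 1 ((R.counts k ω).N h s (R.policy k ω h s)))) := by
  have hopt := vTilde_le_optV hconc hacc hL hx hE₁ hE₂
    (R.counts_N₃_nonneg k ω)
  have hpol := M.polV_castSucc (Policy.deterministic (R.policy k ω)) h s
  have h1 := bellman_sub_qBackup_le hconc hacc hL hx hE₁ hE₂ h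
    (U := M.polV (Policy.deterministic (R.policy k ω)) h.succ)
    (V := vTilde p (R.priv k ω) h.succ) (fun s' => (vTilde_mem _ _ _ s').1) (hopt _)
    (M.optV_le_polV _ _) s (R.policy k ω h s) (by
      rw [← M.polV_deterministic]
      simpa using M.polV_le (Policy.deterministic (R.policy k ω)) h.castSucc s)
  have h2 : qTilde p (R.priv k ω) h s (R.policy k ω h s) ≤ vTilde p (R.priv k ω) h.castSucc s := by
    rw [vTilde_castSucc]
    exact Finset.le_inf' _ _ fun a _ => hgreedy h s a
  have h3 : max 1 ((R.counts k ω).N h s (R.policy k ω h s)) ≤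
      denom p (R.priv k ω) h s (R.policy k ω h s) :=
    max_le (one_le_denom _ _ _ _ _) (hacc.N_le_denom _ _ _)
  have h4 : (0 : ℝ) < max 1 ((R.counts k ω).N h s (R.policy k ω h s)) :=
    lt_of_lt_of_le one_pos (le_max_left _ _)
  have hlow := lowerOrder_nonneg (S := S) (H := H) hx hE₁ hE₂
  rw [← M.polV_deterministic] at h1
  refine (sub_le_sub_left h2 _).trans (h1.trans ?_)
  refine add_le_add le_rfl (add_le_add ?_ ?_)
  · rw [div_eq_mul_one_div]
    refine mul_le_mul_of_nonneg_left ?_ (by positivity)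
    exact one_div_le_one_div_of_le (Real.sqrt_pos.2 h4) (Real.sqrt_le_sqrt h3)
  · rw [div_eq_mul_one_div]
    exact mul_le_mul_of_nonneg_left (one_div_le_one_div_of_le h4 h3) hlow

/-- Optimism bounds the regret by the initial gaps. Summing `gap_step` over episodes at the visited
states, and trading expected for realized next gaps through `hmart`, gives a recursion in `h` to
which `le_of_step_le` applies. -/
theorem Run.regret_le {s₁ : Fin K → S} {X : ℝ} (hL : Lc S A H p = Real.sqrt x) (hx : 0 ≤ x)
    (hE₁ : 0 ≤ p.E₁) (hE₂ : 0 ≤ p.E₂) (hX : 0 ≤ X)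
    (hinit : ∀ k, R.state k 0 ω = s₁ k)
    (hgreedy : ∀ k h s a, qTilde p (R.priv k ω) h s (R.policy k ω h s) ≤
      qTilde p (R.priv k ω) h s a)
    (hacc : ∀ k, CloseTo (R.priv k ω) (R.counts k ω) p.E₁ p.E₂)
    (hconc : ∀ k, Concentrated M (R.counts k ω) x)
    (hmart : ∀ h : Fin H, ∑ k,
      (∑ s', M.P h (R.state k h.castSucc ω) (R.action k h ω) s' * R.gap M p k h.succ s' ω -
        R.gap M p k h.succ (R.state k h.succ ω) ω) ≤ X) :
    R.regret M s₁ ω ≤ 3 * H * (X +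
      (4 * H * Real.sqrt x * (3 * Real.sqrt (Fintype.card S * Fintype.card A * K)) +
        lowerOrder S H p x * (3 * (Fintype.card S * Fintype.card A) * Real.log (K + 1)))) := by
  classical
  have hlow := lowerOrder_nonneg (S := S) (H := H) hx hE₁ hE₂
  have hlog : 0 ≤ Real.log ((K : ℝ) + 1) :=
    Real.log_nonneg (by linarith [Nat.cast_nonneg (α := ℝ) K])
  set B := 4 * H * Real.sqrt x * (3 * Real.sqrt (Fintype.card S * Fintype.card A * K)) +
        lowerOrder S H p x * (3 * (Fintype.card S * Fintype.card A) * Real.log (K + 1)) with hB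
  have hB0 : 0 ≤ B := by positivity
  have hreg : R.regret M s₁ ω ≤ ∑ k, R.gap M p k 0 (R.state k 0 ω) ω := by
    refine Finset.sum_le_sum fun k _ => ?_
    rw [hinit, M.value_eq_polV]
    refine sub_le_sub_left ((vTilde_le_optV (hconc k) (hacc k) hL hx hE₁ hE₂
      (R.counts_N₃_nonneg k ω) 0 _).trans (M.optV_zero_le_optValue _)) _
  refine hreg.trans (le_of_step_le (D := fun h => ∑ k, R.gap M p k h (R.state k h ω) ω)
    (add_nonneg hX hB0) ?_ fun h => ?_)
  · refine Finset.sum_eq_zero fun k _ => ?_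
    simp [Run.gap, MDP.polV_last, vTilde_last]
  · have hγ : 0 ≤ 1 / (H : ℝ) := by positivity
    have hb : ∑ k, (4 * H * Real.sqrt x * (1 / Real.sqrt (max 1 ((R.counts k ω).N h
          (R.state k h.castSucc ω) (R.action k h ω)))) +
        lowerOrder S H p x * (1 / max 1 ((R.counts k ω).N h
          (R.state k h.castSucc ω) (R.action k h ω)))) ≤ B := by
      rw [Finset.sum_add_distrib, ← Finset.mul_sum, ← Finset.mul_sum, hB]
      have h1 : ∑ k, 1 / Real.sqrt (max 1 ((R.counts k ω).N h (R.state k h.castSucc ω)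
          (R.action k h ω))) ≤ 3 * Real.sqrt (Fintype.card S * Fintype.card A * K) := by
        simp_rw [Run.counts_N_eq_card]
        rw [← Nat.cast_mul, ← Fintype.card_prod]
        convert sum_inv_sqrt_visits_le fun k => (R.state k h.castSucc ω, R.action k h ω)
      have h2 : ∑ k, 1 / max 1 ((R.counts k ω).N h (R.state k h.castSucc ω) (R.action k h ω)) ≤
          3 * (Fintype.card S * Fintype.card A) * Real.log (K + 1) := by
        simp_rw [Run.counts_N_eq_card]
        rw [← Nat.cast_mul, ← Fintype.card_prod]
        convert sum_inv_visits_le fun k => (R.state k h.castSucc ω, R.action k h ω)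
      exact add_le_add (mul_le_mul_of_nonneg_left h1 (by positivity))
        (mul_le_mul_of_nonneg_left h2 hlow)
    have hm := hmart h
    rw [Finset.sum_sub_distrib, sub_le_iff_le_add'] at hm
    calc ∑ k, R.gap M p k h.castSucc (R.state k h.castSucc ω) ω
        ≤ ∑ k, ((1 + 1 / (H : ℝ)) * (∑ s', M.P h (R.state k h.castSucc ω) (R.action k h ω) s' *
            R.gap M p k h.succ s' ω) +
          (4 * H * Real.sqrt x * (1 / Real.sqrt (max 1 ((R.counts k ω).N h
            (R.state k h.castSucc ω) (R.action k h ω)))) +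
          lowerOrder S H p x * (1 / max 1 ((R.counts k ω).N h
            (R.state k h.castSucc ω) (R.action k h ω))))) :=
          Finset.sum_le_sum fun k _ =>
            Run.gap_step hL hx hE₁ hE₂ k (hgreedy k) (hacc k) (hconc k) h _
      _ ≤ (1 + 1 / (H : ℝ)) * (∑ k, R.gap M p k h.succ (R.state k h.succ ω) ω + X) + B := by
          rw [Finset.sum_add_distrib, ← Finset.mul_sum]
          exact add_le_add (mul_le_mul_of_nonneg_left hm (by linarith)) hb
      _ ≤ _ := by nlinarith [mul_nonneg hγ hB0]

end Pathwise


/-! ### Concentration of the counts of a run -/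

section Measurability

variable {Ω S A : Type*} {m : MeasurableSpace Ω} {H : ℕ}

/-- States and actions carry no measurable structure; only the fibres of `y` are known to be
measurable, and finitely many of them suffice. -/
theorem measurable_apply_of_finite {α : Type*} [Fintype α] {y : Ω → α} {f : α → Ω → ℝ}
    (hy : ∀ b, MeasurableSet {ω | y ω = b}) (hf : ∀ b, Measurable (f b)) :
    Measurable fun ω => f (y ω) ω := by
  classical
  have : (fun ω => f (y ω) ω) = fun ω => ∑ b, {ω | y ω = b}.indicator (f b) ω := by
    ext ω
    simp [Set.indicator_apply]
  rw [this]
  exact Finset.measurable_fun_sum _ fun b _ => (hf b).indicator (hy b)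

theorem measurable_inf'_univ {α : Type*} [Fintype α] [Nonempty α] {f : α → Ω → ℝ}
    (hf : ∀ a, Measurable (f a)) :
    Measurable fun ω => Finset.univ.inf' Finset.univ_nonempty fun a => f a ω := by
  simp_rw [Finset.inf'_univ_eq_ciInf]
  exact Measurable.iInf hf

variable [Fintype S] [Fintype A]

theorem measurable_polV (M : MDP S A H) {π : Ω → Fin H → S → A}
    (hπ : ∀ h s a, MeasurableSet {ω | π ω h s = a}) (h : Fin (H + 1)) (s : S) :
    Measurable fun ω => M.polV (Policy.deterministic (π ω)) h s := by
  induction h using Fin.reverseInduction generalizing s with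
  | last => simp [MDP.polV_last]
  | cast h ih =>
    simp_rw [MDP.polV_deterministic]
    exact measurable_apply_of_finite (f := fun a ω => M.c h s a +
      ∑ s', M.P h s a s' * M.polV (Policy.deterministic (π ω)) h.succ s') (hπ h s) fun a =>
      (Finset.measurable_fun_sum _ fun s' _ => (ih s').const_mul _).const_add _

variable [Nonempty A]

theorem measurable_vTilde (p : Params) {n : Ω → Counts S A H}
    (hC : ∀ h s a, Measurable fun ω => (n ω).C h s a)
    (hN : ∀ h s a, Measurable fun ω => (n ω).N h s a)
    (hN₃ : ∀ h s a s', Measurable fun ω => (n ω).N₃ h s a s') (h : Fin (H + 1)) (s : S) :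
    Measurable fun ω => vTilde p (n ω) h s := by
  induction h using Fin.reverseInduction generalizing s with
  | last => simp [vTilde_last]
  | cast h ih =>
    simp_rw [vTilde_castSucc]
    have hD : ∀ a, Measurable fun ω => denom p (n ω) h s a := fun a =>
      measurable_const.max ((hN h s a).add_const _)
    have hq : ∀ a, Measurable fun ω => qTilde p (n ω) h s a := fun a => by
      have hP : ∀ s', Measurable fun ω => PTilde p (n ω) h s a s' := fun s' =>
        (hN₃ h s a s').div (hD a)
      have hbC : Measurable fun ω => bonusC p (n ω) h s a :=
        ((hD a).sqrt.const_div _).add ((hD a).const_div _)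
      have hbV : Measurable fun ω => bonusPV p (n ω) h s a :=
        ((hD a).sqrt.const_div _).add ((hD a).const_div _)
      exact measurable_const.min (measurable_const.max
        ((((hC h s a).div (hD a)).add
          (Finset.measurable_fun_sum _ fun s' _ => (ih s').mul (hP s'))).sub (hbC.add hbV)))
    exact measurable_inf'_univ hq

end Measurability

/-! ### Visits as events, and counts as sums of their indicators -/

section Visits

variable {Ω S A : Type*} {H K : ℕ}

/-- The event that `(s, a)` is visited at step `h` of episode `k`. -/
def Run.visit (R : Run Ω S A H K) (h : Fin H) (s : S) (a : A) (k : Fin K) : Set Ω :=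
  {ω | R.state k h.castSucc ω = s ∧ R.action k h ω = a}

open Classical in
theorem Run.counts_N (R : Run Ω S A H K) (k : Fin K) (ω : Ω) (h : Fin H) (s : S) (a : A) :
    (R.counts k ω).N h s a =
      ∑ j ∈ before K k, (R.visit h s a j).indicator (fun _ => (1 : ℝ)) ω := by
  rw [before_val]
  exact Finset.sum_congr rfl fun j _ => by
    simp only [Run.visit, Set.indicator_apply, Set.mem_ofPred_eq]

end Visits

/-! ### Deviation events of a run and their probabilities -/

section Events

variable {Ω S A : Type*} [Fintype S] [Fintype A] [Nonempty A] {H K : ℕ}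
  {mΩ : MeasurableSpace Ω} {μ : Measure Ω} {ℱ : Filtration ℕ mΩ} {M : MDP S A H} {s₁ : Fin K → S}
  {δ E₁ E₂ : ℝ} {R : Run Ω S A H K}

theorem IsUCBVIRun.visit_meas (hR : IsUCBVIRun μ ℱ M s₁ δ E₁ E₂ R) (h : Fin H) (s : S) (a : A)
    (k : Fin K) : MeasurableSet[ℱ (k * H + h)] (R.visit h s a k) := by
  have h1 := hR.state_meas k h.castSucc s
  have h2 := ℱ.mono (Nat.le_add_right (k * H) h) _ (hR.policy_meas k h s a)
  have : R.visit h s a k = {ω | R.state k h.castSucc ω = s} ∩ {ω | R.policy k ω h s = a} := by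
    ext ω
    simp only [Run.visit, Run.action, Set.mem_ofPred_eq, Set.mem_inter_iff]
    constructor
    · rintro ⟨rfl, h⟩; exact ⟨rfl, h⟩
    · rintro ⟨rfl, h⟩; exact ⟨rfl, h⟩
  rw [this]
  exact MeasurableSet.inter h1 h2

theorem IsUCBVIRun.measurable_visit (hR : IsUCBVIRun μ ℱ M s₁ δ E₁ E₂ R) (h : Fin H)
    (f : S → A → ℝ) (k : Fin K) :
    Measurable[ℱ (k * H + h)] fun ω => f (R.state k h.castSucc ω) (R.action k h ω) := by
  refine measurable_apply_of_finite (m := ℱ (k * H + h))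
    (y := fun ω => (R.state k h.castSucc ω, R.action k h ω))
    (f := fun (b : S × A) _ => f b.1 b.2) (fun b => ?_) fun b => measurable_const
  have := hR.visit_meas h b.1 b.2 k
  convert this using 1
  ext ω
  simp [Run.visit, Prod.ext_iff]

/-- Information before step `h` of each episode. -/
abbrev atStep (ℱ : Filtration ℕ mΩ) (H h : ℕ) (j : ℕ) : MeasurableSpace Ω := ℱ (j * H + h)

theorem atStep_mono (ℱ : Filtration ℕ mΩ) (H h : ℕ) : Monotone (atStep ℱ H h) := fun _ _ hij =>
  ℱ.mono (Nat.add_le_add_right (Nat.mul_le_mul_right H hij) h)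

/-- For fixed `h` the filtration is sampled once per episode. The outcome of step `h` is known
before step `h` of the next episode, so the episodes form a single sequence of observations. -/
theorem step_succ_le (h : Fin H) (k : ℕ) : k * H + h + 1 ≤ (k + 1) * H + h := by
  have := h.isLt
  rw [add_mul]
  omega

theorem IsUCBVIRun.observations_cost (hR : IsUCBVIRun μ ℱ M s₁ δ E₁ E₂ R) (h : Fin H)
    {I : Fin K → Set Ω} (hI : ∀ k : Fin K, MeasurableSet[ℱ (k * H + h)] (I k)) :
    Observations μ (atStep ℱ H h) (fun k => R.cost k h)
      (fun k ω => M.c h (R.state k h.castSucc ω) (R.action k h ω)) I where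
  le _ := ℱ.le _
  mono := atStep_mono ℱ H h
  meas k := (hR.cost_meas k h).mono (ℱ.mono (step_succ_le h k)) le_rfl
  mem k := hR.cost_mem k h
  mean_meas k := hR.measurable_visit h (M.c h) k
  mean_mem _ _ := ⟨M.c_nonneg _ _ _, M.c_le_one _ _ _⟩
  mean k := hR.cost_mean k h
  set_meas := hI

theorem IsUCBVIRun.state_succ_meas (hR : IsUCBVIRun μ ℱ M s₁ δ E₁ E₂ R) (h : Fin H) (k : Fin K)
    (s' : S) : MeasurableSet[atStep ℱ H h (k + 1)] {ω | R.state k h.succ ω = s'} :=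
  ℱ.mono (step_succ_le h k) _ (hR.state_meas k h.succ s')

theorem IsUCBVIRun.measurable_gap (hR : IsUCBVIRun μ ℱ M s₁ δ E₁ E₂ R) (p : Params) (k : Fin K)
    (h : Fin (H + 1)) (s : S) : Measurable[ℱ (k * H)] (R.gap M p k h s) :=
  Measurable.sub (m := ℱ (k * H)) (measurable_polV (m := ℱ (k * H)) M (hR.policy_meas k) h s)
    (measurable_vTilde (m := ℱ (k * H)) p (hR.priv_meas_C k) (hR.priv_meas_N k)
      (hR.priv_meas_N₃ k) h s)

variable [IsProbabilityMeasure μ]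

/-- Expand over the finitely many next states and pull the known factors `g s'` out of the
conditional expectation. Letting `g` be random is what accommodates the gaps. -/
theorem IsUCBVIRun.condExp_next (hR : IsUCBVIRun μ ℱ M s₁ δ E₁ E₂ R) (h : Fin H) (k : Fin K)
    {g : S → Ω → ℝ} (hg : ∀ s', Measurable[ℱ (k * H + h)] (g s'))
    (hg1 : ∀ s' ω, g s' ω ∈ Set.Icc (0 : ℝ) 1) :
    μ[fun ω => g (R.state k h.succ ω) ω | ℱ (k * H + h)] =ᵐ[μ]
      fun ω => ∑ s', M.P h (R.state k h.castSucc ω) (R.action k h ω) s' * g s' ω := by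
  classical
  set e : S → Ω → ℝ := fun s' ω => if R.state k h.succ ω = s' then (1 : ℝ) else 0 with he
  have hem : ∀ s', Measurable (e s') := fun s' =>
    Measurable.ite (ℱ.le _ _ (hR.state_meas k h.succ s')) measurable_const measurable_const
  have hei : ∀ s', Integrable (e s') μ := fun s' => by
    refine Integrable.of_bound (C := 1) (hem s').aestronglyMeasurable
      (Filter.Eventually.of_forall fun ω => ?_)
    simp only [he]
    split_ifs <;> simp
  have hgi : ∀ s', Integrable (g s' * e s') μ := fun s' =>
    (hei s').bdd_mul (c := 1) ((hg s').mono (ℱ.le _) le_rfl).aestronglyMeasurable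
      (Filter.Eventually.of_forall fun ω => by
        rw [Real.norm_eq_abs, abs_of_nonneg (hg1 s' ω).1]; exact (hg1 s' ω).2)
  have hsum : (fun ω => g (R.state k h.succ ω) ω) = ∑ s', g s' * e s' := by
    ext ω
    simp [he]
  rw [hsum]
  have h1 := condExp_finsetSum (μ := μ) (s := Finset.univ) (f := fun s' => g s' * e s')
    (fun s' _ => hgi s') (ℱ (k * H + h))
  have h2 : ∀ s', μ[g s' * e s' | ℱ (k * H + h)] =ᵐ[μ] g s' * μ[e s' | ℱ (k * H + h)] := fun s' =>
    condExp_mul_of_stronglyMeasurable_left (hg s').stronglyMeasurable (hgi s') (hei s')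
  filter_upwards [h1, ae_all_iff.2 h2, ae_all_iff.2 fun s' => hR.state_next k h s']
    with ω h1 h2 h3
  rw [h1, Finset.sum_apply]
  refine Finset.sum_congr rfl fun s' _ => ?_
  rw [h2, Pi.mul_apply, mul_comm]
  congr 1
  exact h3 s'

/-- Used with three functions of the next state: `optV / H`, the indicator of a single state, and
the rescaled gap. -/
theorem IsUCBVIRun.observations_next (hR : IsUCBVIRun μ ℱ M s₁ δ E₁ E₂ R) (h : Fin H)
    {I : Fin K → Set Ω} (hI : ∀ k : Fin K, MeasurableSet[ℱ (k * H + h)] (I k))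
    {g : Fin K → S → Ω → ℝ} (hg : ∀ (k : Fin K) s', Measurable[ℱ (k * H + h)] (g k s'))
    (hg1 : ∀ k s' ω, g k s' ω ∈ Set.Icc (0 : ℝ) 1) :
    Observations μ (atStep ℱ H h) (fun k ω => g k (R.state k h.succ ω) ω)
      (fun k ω => ∑ s', M.P h (R.state k h.castSucc ω) (R.action k h ω) s' * g k s' ω) I where
  le _ := ℱ.le _
  mono := atStep_mono ℱ H h
  meas k := measurable_apply_of_finite (m := atStep ℱ H h (k + 1)) (hR.state_succ_meas h k)
    fun s' => (hg k s').mono (atStep_mono ℱ H h (Nat.le_succ _)) le_rfl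
  mem k := Filter.Eventually.of_forall fun ω => hg1 k _ ω
  mean_meas k := by
    refine Finset.measurable_fun_sum _ fun s' _ => Measurable.mul ?_ (hg k s')
    exact hR.measurable_visit h (fun s a => M.P h s a s') k
  mean_mem k ω := ⟨M.sum_P_mul_nonneg _ _ _ fun s' => (hg1 k s' ω).1,
    M.sum_P_mul_le _ _ _ fun s' => (hg1 k s' ω).2⟩
  mean k := hR.condExp_next h k (hg k) (hg1 k)
  set_meas := hI

/-- The event that the cost counts of `(h, s, a)` before episode `k` deviate. -/
def costDeviation (M : MDP S A H) (R : Run Ω S A H K) (x : ℝ) (k : Fin K) (h : Fin H) (s : S)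
    (a : A) : Set Ω :=
  {ω | Real.sqrt ((R.counts k ω).N h s a * x / 2) <
    |(R.counts k ω).C h s a - (R.counts k ω).N h s a * M.c h s a|}

theorem IsUCBVIRun.costDeviation_le (hR : IsUCBVIRun μ ℱ M s₁ δ E₁ E₂ R) {x : ℝ} (hx : 0 < x)
    (k : Fin K) (h : Fin H) (s : S) (a : A) :
    μ.real (costDeviation M R x k h s a) ≤ 2 * K * Real.exp (-x) := by
  classical
  refine le_trans (le_of_eq ?_)
    ((hR.observations_cost h (hR.visit_meas h s a)).deviation (k : ℕ) hx)
  congr 1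
  ext ω
  simp only [costDeviation, Set.mem_ofPred_eq]
  rw [R.counts_N]
  have : (R.counts k ω).C h s a - (∑ j ∈ before K k,
      (R.visit h s a j).indicator (fun _ => (1 : ℝ)) ω) * M.c h s a =
      ∑ j ∈ before K k, (R.visit h s a j).indicator (fun ω => R.cost j h ω -
        M.c h (R.state j h.castSucc ω) (R.action j h ω)) ω := by
    rw [Finset.sum_mul, before_val]
    simp only [Run.counts]
    rw [← Finset.sum_sub_distrib]
    refine Finset.sum_congr rfl fun j _ => ?_
    simp only [Run.visit, Set.indicator_apply, Set.mem_ofPred_eq]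
    split_ifs with hv
    · rw [hv.1, hv.2, one_mul]
    · simp
  rw [this]

/-- The event that the transition counts of `(h, s, a)` before episode `k` deviate when they are
applied to the optimal value function. -/
def optDeviation (M : MDP S A H) (R : Run Ω S A H K) (x : ℝ) (k : Fin K) (h : Fin H) (s : S)
    (a : A) : Set Ω :=
  {ω | H * Real.sqrt ((R.counts k ω).N h s a * x / 2) <
    |∑ s', (R.counts k ω).N₃ h s a s' * M.optV h.succ s' -
      (R.counts k ω).N h s a * ∑ s', M.P h s a s' * M.optV h.succ s'|}

theorem IsUCBVIRun.optDeviation_le (hR : IsUCBVIRun μ ℱ M s₁ δ E₁ E₂ R) {x : ℝ} (hx : 0 < x)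
    (k : Fin K) (h : Fin H) (s : S) (a : A) :
    μ.real (optDeviation M R x k h s a) ≤ 2 * K * Real.exp (-x) := by
  classical
  have hH : (0 : ℝ) < H := by exact_mod_cast (Nat.pos_of_ne_zero fun h0 => by
    subst h0; exact h.elim0)
  refine le_trans (le_of_eq ?_)
    ((hR.observations_next h (hR.visit_meas h s a) (g := fun _ s' _ => M.optV h.succ s' / H)
      (fun _ _ => measurable_const) (fun _ s' _ => ⟨div_nonneg (M.optV_nonneg _ _) hH.le,
        (div_le_one hH).2 ((M.optV_le h.succ s').trans (sub_le_self _ (Nat.cast_nonneg _)))⟩)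
      ).deviation (k : ℕ) hx)
  congr 1
  ext ω
  simp only [optDeviation, Set.mem_ofPred_eq]
  have : ∑ s', (R.counts k ω).N₃ h s a s' * M.optV h.succ s' - (∑ j ∈ before K k,
      (R.visit h s a j).indicator (fun _ => (1 : ℝ)) ω) *
        ∑ s', M.P h s a s' * M.optV h.succ s' =
      H * ∑ j ∈ before K k, (R.visit h s a j).indicator
        (fun ω => M.optV h.succ (R.state j h.succ ω) / H -
          ∑ s', M.P h (R.state j h.castSucc ω) (R.action j h ω) s' *
            (M.optV h.succ s' / H)) ω := by
    rw [Finset.sum_mul, before_val, Finset.mul_sum]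
    simp only [Run.counts, Finset.sum_mul]
    rw [Finset.sum_comm, ← Finset.sum_sub_distrib]
    refine Finset.sum_congr rfl fun j _ => ?_
    simp only [Run.visit, Set.indicator_apply, Set.mem_ofPred_eq]
    by_cases hv : R.state j h.castSucc ω = s ∧ R.action j h ω = a
    · simp only [hv, true_and, and_self, if_true, one_mul, ite_mul, zero_mul, Finset.sum_ite_eq,
        Finset.mem_univ, mul_sub]
      rw [mul_div_cancel₀ _ hH.ne', Finset.mul_sum]
      congr 1
      exact Finset.sum_congr rfl fun s' _ => by field_simp
    · rw [if_neg hv, if_neg hv]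
      have : ∀ s', ¬ (R.state j h.castSucc ω = s ∧ R.action j h ω = a ∧
        R.state j h.succ ω = s') := fun s' h => hv ⟨h.1, h.2.1⟩
      simp [this]
  rw [R.counts_N, this, abs_mul, abs_of_pos hH, mul_lt_mul_iff_right₀ hH]

/-- The event that the number of transitions from `(h, s, a)` to `s'` before episode `k` is much
larger than its mean. -/
def transDeviation (M : MDP S A H) (R : Run Ω S A H K) (x : ℝ) (k : Fin K) (h : Fin H) (s : S)
    (a : A) (s' : S) : Set Ω :=
  {ω | (1 + 1 / (H : ℝ)) * M.P h s a s' * (R.counts k ω).N h s a + H * x <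
    (R.counts k ω).N₃ h s a s'}

/-- Chernoff at `u = 1/H`, multiplied by `H`, has relative factor `H (e^{1/H} - 1)` and additive
term `H x`. The bound is `e^t - 1 - t ≤ t²` at `t = 1/H`. -/
theorem exp_inv_sub_one_le {H : ℝ} (hH : 1 ≤ H) :
    H * (Real.exp (1 / H) - 1) ≤ 1 + 1 / H := by
  have h0 : 0 < H := by linarith
  have h1 : |1 / H| ≤ 1 := by
    rw [abs_of_pos (by positivity), div_le_one h0]; exact hH
  have h2 := (abs_le.1 (Real.abs_exp_sub_one_sub_id_le h1)).2
  calc _ ≤ H * (1 / H + (1 / H) ^ 2) := mul_le_mul_of_nonneg_left (by linarith) h0.le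
    _ = _ := by field_simp

theorem IsUCBVIRun.transDeviation_le (hR : IsUCBVIRun μ ℱ M s₁ δ E₁ E₂ R) (x : ℝ)
    (k : Fin K) (h : Fin H) (s : S) (a : A) (s' : S) :
    μ.real (transDeviation M R x k h s a s') ≤ Real.exp (-x) := by
  classical
  have hH : (1 : ℝ) ≤ H := by exact_mod_cast (Nat.pos_of_ne_zero fun h0 => by
    subst h0; exact h.elim0)
  have hH0 : (0 : ℝ) < H := by linarith
  refine le_trans (measureReal_mono ?_ (measure_ne_top _ _))
    ((hR.observations_next h (hR.visit_meas h s a)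
      (g := fun _ r _ => if r = s' then (1 : ℝ) else 0)
      (fun _ _ => measurable_const) (fun _ r _ => by split_ifs <;> simp)
      ).chernoff (1 / (H : ℝ)) (k : ℕ) x)
  intro ω hω
  simp only [transDeviation, Set.mem_ofPred_eq] at hω ⊢
  have : ∑ j ∈ before K k, (R.visit h s a j).indicator
      (fun ω => 1 / (H : ℝ) * (if R.state j h.succ ω = s' then (1 : ℝ) else 0) -
        (Real.exp (1 / (H : ℝ)) - 1) *
          ∑ r, M.P h (R.state j h.castSucc ω) (R.action j h ω) r *
            (if r = s' then (1 : ℝ) else 0)) ω =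
      1 / (H : ℝ) * (R.counts k ω).N₃ h s a s' -
        (Real.exp (1 / (H : ℝ)) - 1) * M.P h s a s' * (R.counts k ω).N h s a := by
    rw [before_val]
    simp only [Run.counts, Finset.mul_sum]
    rw [← Finset.sum_sub_distrib]
    refine Finset.sum_congr rfl fun j _ => ?_
    simp only [Run.visit, Set.indicator_apply, Set.mem_ofPred_eq]
    by_cases hv : R.state j h.castSucc ω = s ∧ R.action j h ω = a
    · simp [hv]
    · rw [if_neg hv, if_neg hv, if_neg fun h => hv ⟨h.1, h.2.1⟩]
      simp
  rw [this]
  have hN : 0 ≤ (R.counts k ω).N h s a := by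
    rw [R.counts_N_eq_card]; exact Nat.cast_nonneg _
  have h1 := mul_le_mul_of_nonneg_right (exp_inv_sub_one_le hH)
    (mul_nonneg (M.P_nonneg h s a s') hN)
  refine le_of_mul_le_mul_left ?_ hH0
  rw [mul_sub, ← mul_assoc, mul_one_div_cancel hH0.ne', one_mul]
  linarith

/-- The event that, at step `h`, the realized next gaps deviate from their conditional means. -/
def gapDeviation (M : MDP S A H) (R : Run Ω S A H K) (p : Params) (x : ℝ) (h : Fin H) : Set Ω :=
  {ω | 2 * H * Real.sqrt (K * x / 2) < ∑ k,
    (∑ s', M.P h (R.state k h.castSucc ω) (R.action k h ω) s' * R.gap M p k h.succ s' ω -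
      R.gap M p k h.succ (R.state k h.succ ω) ω)}

theorem IsUCBVIRun.gapDeviation_le (hR : IsUCBVIRun μ ℱ M s₁ δ E₁ E₂ R) (p : Params) {x : ℝ}
    (hx : 0 < x) (h : Fin H) :
    μ.real (gapDeviation M R p x h) ≤ 2 * K * Real.exp (-x) := by
  have hH : (0 : ℝ) < H := by exact_mod_cast (Nat.pos_of_ne_zero fun h0 => by
    subst h0; exact h.elim0)
  refine le_trans (measureReal_mono ?_ (measure_ne_top _ _))
    -- Off the good event a gap may be negative, so `[-H, H]` is mapped affinely to `[0, 1]`. The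
    -- shift cancels since transition probabilities sum to one, and the scale `2 H` appears in the
    -- threshold. Every episode counts, so the number of observations is `K`.
    ((hR.observations_next h (I := fun _ => Set.univ) (fun _ => MeasurableSet.univ)
      (g := fun k s' ω => (R.gap M p k h.succ s' ω + H) / (2 * H))
      (fun (k : Fin K) s' => (((hR.measurable_gap p k h.succ s').mono
        (ℱ.mono (Nat.le_add_right _ _)) le_rfl).add_const _).div_const _)
      (fun k s' ω => by
        have := abs_le.1 (R.abs_gap_le M p k h.succ s' ω)
        exact ⟨div_nonneg (by linarith) (by positivity),
          (div_le_one (by positivity)).2 (by linarith)⟩)).deviation K hx)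
  intro ω hω
  simp only [gapDeviation, Set.mem_ofPred_eq, before_self, Set.indicator_univ, Finset.sum_const,
    Finset.card_univ, Fintype.card_fin, nsmul_eq_mul, mul_one] at hω ⊢
  have : ∀ k, (R.gap M p k h.succ (R.state k h.succ ω) ω + H) / (2 * H) -
      ∑ s', M.P h (R.state k h.castSucc ω) (R.action k h ω) s' *
        ((R.gap M p k h.succ s' ω + H) / (2 * H)) =
      -((∑ s', M.P h (R.state k h.castSucc ω) (R.action k h ω) s' * R.gap M p k h.succ s' ω -
      R.gap M p k h.succ (R.state k h.succ ω) ω) / (2 * H)) := by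
    intro k
    have h1 : ∑ s', M.P h (R.state k h.castSucc ω) (R.action k h ω) s' *
        ((R.gap M p k h.succ s' ω + H) / (2 * H)) =
        (∑ s', M.P h (R.state k h.castSucc ω) (R.action k h ω) s' * R.gap M p k h.succ s' ω + H) /
          (2 * H) := by
      simp_rw [← mul_div_assoc, mul_add]
      rw [← Finset.sum_div, Finset.sum_add_distrib, ← Finset.sum_mul, M.P_sum, one_mul]
    rw [h1]
    ring
  simp_rw [this]
  rw [Finset.sum_neg_distrib, abs_neg, ← Finset.sum_div]
  refine lt_of_lt_of_le ?_ (le_abs_self _)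
  rw [lt_div_iff₀ (by positivity)]
  linarith

end Events


/-! ### The regret bound -/

section Final

variable {Ω S A : Type*} [Fintype S] [Fintype A] [Nonempty A] {H K : ℕ}
  {mΩ : MeasurableSpace Ω} {μ : Measure Ω} {ℱ : Filtration ℕ mΩ} {M : MDP S A H} {s₁ : Fin K → S}
  {δ E₁ E₂ : ℝ} {R : Run Ω S A H K}

/-- The event that some count or gap deviates. -/
def deviation (M : MDP S A H) (R : Run Ω S A H K) (p : Params) (x : ℝ) : Set Ω :=
  ((⋃ i : Fin K × Fin H × S × A, costDeviation M R x i.1 i.2.1 i.2.2.1 i.2.2.2) ∪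
    (⋃ i : Fin K × Fin H × S × A, optDeviation M R x i.1 i.2.1 i.2.2.1 i.2.2.2)) ∪
  ((⋃ i : (Fin K × Fin H × S × A) × S,
      transDeviation M R x i.1.1 i.1.2.1 i.1.2.2.1 i.1.2.2.2 i.2) ∪
    ⋃ h : Fin H, gapDeviation M R p x h)

theorem measureReal_iUnion_le_card_mul [IsProbabilityMeasure μ] {ι : Type*} [Fintype ι]
    {f : ι → Set Ω} {B : ℝ} (hf : ∀ i, μ.real (f i) ≤ B) :
    μ.real (⋃ i, f i) ≤ Fintype.card ι * B := by
  refine (measureReal_iUnion_fintype_le f).trans ((Finset.sum_le_sum fun i _ => hf i).trans ?_)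
  simp

theorem IsUCBVIRun.deviation_le [IsProbabilityMeasure μ] (hR : IsUCBVIRun μ ℱ M s₁ δ E₁ E₂ R)
    (p : Params) {x : ℝ} (hx : 0 < x) :
    μ.real (deviation M R p x) ≤
      (4 * (K * (H * (Fintype.card S * Fintype.card A))) * K +
        K * (H * (Fintype.card S * Fintype.card A)) * Fintype.card S + 2 * H * K) *
          Real.exp (-x) := by
  have h1 := measureReal_iUnion_le_card_mul (μ := μ) fun i : Fin K × Fin H × S × A =>
    hR.costDeviation_le hx i.1 i.2.1 i.2.2.1 i.2.2.2
  have h2 := measureReal_iUnion_le_card_mul (μ := μ) fun i : Fin K × Fin H × S × A =>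
    hR.optDeviation_le hx i.1 i.2.1 i.2.2.1 i.2.2.2
  have h3 := measureReal_iUnion_le_card_mul (μ := μ) fun i : (Fin K × Fin H × S × A) × S =>
    hR.transDeviation_le x i.1.1 i.1.2.1 i.1.2.2.1 i.1.2.2.2 i.2
  have h4 := measureReal_iUnion_le_card_mul (μ := μ) fun h : Fin H =>
    hR.gapDeviation_le p hx h
  simp only [Fintype.card_prod, Fintype.card_fin, Nat.cast_mul] at h1 h2 h3 h4
  refine (measureReal_union_le _ _).trans ((add_le_add (measureReal_union_le _ _)
    (measureReal_union_le _ _)).trans ?_)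
  linarith

theorem Run.concentrated_of_notMem {p : Params} {x : ℝ} {ω : Ω} (hω : ω ∉ deviation M R p x)
    (k : Fin K) : Concentrated M (R.counts k ω) x := by
  simp only [deviation, Set.mem_union, Set.mem_iUnion, not_or, not_exists] at hω
  obtain ⟨⟨h1, h2⟩, h3, -⟩ := hω
  exact
  { N_nonneg := fun h s a => by
      classical
      rw [R.counts_N_eq_card]; exact Nat.cast_nonneg _
    cost := fun h s a => not_lt.1 (h1 (k, h, s, a))
    opt := fun h s a => not_lt.1 (h2 (k, h, s, a))
    trans := fun h s a s' => not_lt.1 (h3 ((k, h, s, a), s')) }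

/-- The deviation bound in terms of `u = S A T`, at the level `2 log (4 u / δ)`. -/
theorem failure_le {K H S A δ : ℝ} (hK : 1 ≤ K) (hH : 1 ≤ H) (hS : 1 ≤ S) (hA : 1 ≤ A) (hδ : 0 < δ)
    (hδ1 : δ ≤ 1) :
    (4 * (K * (H * (S * A))) * K + K * (H * (S * A)) * S + 2 * H * K) *
      Real.exp (-(2 * Real.log (4 * S * A * (K * H) / δ))) ≤ δ := by
  set u := K * (H * (S * A)) with hu
  have hSA : 1 ≤ S * A := one_le_mul_of_one_le_of_one_le hS hA
  have hHSA : 1 ≤ H * (S * A) := one_le_mul_of_one_le_of_one_le hH hSA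
  have hKu : K ≤ u := le_mul_of_one_le_right (by linarith) hHSA
  have hSu : S ≤ u := by
    calc S ≤ S * A := le_mul_of_one_le_right (by linarith) hA
      _ ≤ H * (S * A) := le_mul_of_one_le_left (by linarith) hH
      _ ≤ u := le_mul_of_one_le_left (by linarith) hK
  have hu1 : 1 ≤ u := hK.trans hKu
  have hHK : H * K ≤ u := by
    calc H * K ≤ H * K * (S * A) := le_mul_of_one_le_right (by positivity) hSA
      _ = u := by rw [hu]; ring
  have hexp : Real.exp (-(2 * Real.log (4 * S * A * (K * H) / δ))) = δ ^ 2 / (16 * u ^ 2) := by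
    rw [show 4 * S * A * (K * H) / δ = 4 * u / δ by rw [hu]; ring, Real.exp_neg,
      show 2 * Real.log (4 * u / δ) = ((2 : ℕ) : ℝ) * Real.log (4 * u / δ) by norm_num,
      Real.exp_nat_mul, Real.exp_log (by positivity)]
    field_simp
    norm_num
  rw [hexp, mul_div_assoc', div_le_iff₀ (by positivity)]
  -- Each of `K`, `S` and `H * K` is at most `u`, and `1 ≤ u`. The `16 u²` from the exponential then
  -- beats `7 u²`.
  have h1 : 4 * u * K + u * S + 2 * H * K ≤ 7 * u ^ 2 := by nlinarith
  have h2 : δ ^ 2 ≤ δ := by nlinarith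
  calc _ ≤ 7 * u ^ 2 * δ := mul_le_mul h1 h2 (by positivity) (by positivity)
    _ ≤ _ := by nlinarith [mul_pos hδ (show 0 < u ^ 2 by positivity)]

/-- Numerical simplification of the pathwise bound; `l` is the logarithmic factor. -/
theorem final_bound_le {K H S A E₁ E₂ l x : ℝ} (hK : 1 ≤ K) (hH : 1 ≤ H) (hS : 1 ≤ S) (hA : 1 ≤ A)
    (hE₁ : 0 ≤ E₁) (hE₂ : 0 ≤ E₂) (hl : 1 ≤ l) (hx0 : 0 ≤ x) (hx : x ≤ 4 * l)
    (hKl : Real.log (K + 1) ≤ l) :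
    3 * H * (2 * H * Real.sqrt (K * x / 2) +
      (4 * H * Real.sqrt x * (3 * Real.sqrt (S * A * K)) +
        (2 * H + 10 * H * E₁ + 3 * H * (S * E₂) + S * H ^ 2 * x) *
          (3 * (S * A) * Real.log (K + 1)))) ≤
    100 * (Real.sqrt (S * A * H ^ 3 * (K * H)) + S ^ 2 * A * H ^ 3 + S ^ 2 * A * H ^ 2 * E₁ +
      S ^ 2 * A * H ^ 2 * E₂) * l ^ 2 := by
  have hSA : 1 ≤ S * A := one_le_mul_of_one_le_of_one_le hS hA
  set r := Real.sqrt (S * A * K) with hr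
  have hr0 : 0 ≤ r := Real.sqrt_nonneg _
  have hsx : Real.sqrt x ≤ 2 * l := by
    rw [Real.sqrt_le_left (by linarith)]
    nlinarith
  have h1 : Real.sqrt (S * A * H ^ 3 * (K * H)) = H ^ 2 * r := by
    rw [show S * A * H ^ 3 * (K * H) = (H ^ 2) ^ 2 * (S * A * K) by ring,
      Real.sqrt_mul (by positivity), Real.sqrt_sq (by positivity)]
  have h2 : Real.sqrt (K * x / 2) ≤ 2 * l * r := by
    calc Real.sqrt (K * x / 2) ≤ Real.sqrt (x * (S * A * K)) := by
          apply Real.sqrt_le_sqrt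
          have : K * x ≤ S * A * K * x := by
            rw [mul_assoc]; exact le_mul_of_one_le_left (by positivity) hSA
          nlinarith [mul_nonneg (show 0 ≤ K by linarith) hx0]
      _ = Real.sqrt x * r := Real.sqrt_mul hx0 _
      _ ≤ _ := mul_le_mul_of_nonneg_right hsx hr0
  have hl2 : l ≤ l ^ 2 := by nlinarith
  have hlog0 : 0 ≤ Real.log (K + 1) := Real.log_nonneg (by linarith)
  have h3 : (2 * H + 10 * H * E₁ + 3 * H * (S * E₂) + S * H ^ 2 * x) ≤
      S * H * (6 * H + 10 * E₁ + 3 * E₂) * l := by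
    have a1 : 2 * H ≤ 2 * (S * H ^ 2 * l) := by
      have : 1 ≤ S * H * l := one_le_mul_of_one_le_of_one_le
        (one_le_mul_of_one_le_of_one_le hS hH) hl
      nlinarith
    have a2 : H * E₁ ≤ S * H * E₁ * l := by
      have : 1 ≤ S * l := one_le_mul_of_one_le_of_one_le hS hl
      nlinarith [mul_nonneg (show 0 ≤ H by linarith) hE₁]
    have a3 : H * (S * E₂) ≤ S * H * E₂ * l := by
      have : 0 ≤ H * (S * E₂) := by positivity
      nlinarith
    have a4 : S * H ^ 2 * x ≤ S * H ^ 2 * (4 * l) := mul_le_mul_of_nonneg_left hx (by positivity)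
    nlinarith
  have h4 : (2 * H + 10 * H * E₁ + 3 * H * (S * E₂) + S * H ^ 2 * x) *
      (3 * (S * A) * Real.log (K + 1)) ≤
      S * H * (6 * H + 10 * E₁ + 3 * E₂) * l * (3 * (S * A) * l) :=
    mul_le_mul h3 (mul_le_mul_of_nonneg_left hKl (by positivity)) (by positivity) (by positivity)
  have h5 : 4 * H * Real.sqrt x * (3 * r) ≤ 24 * (H * r * l) := by
    nlinarith [mul_le_mul_of_nonneg_left hsx (show 0 ≤ H * r by positivity)]
  have h6 : 2 * H * Real.sqrt (K * x / 2) ≤ 4 * (H * r * l) := by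
    nlinarith [mul_le_mul_of_nonneg_left h2 (show 0 ≤ H by linarith)]
  have h7 : H * r * l ≤ H * r * l ^ 2 := mul_le_mul_of_nonneg_left hl2 (by positivity)
  have hp : 0 ≤ H ^ 2 * r * l ^ 2 := by positivity
  have hp1 : 0 ≤ S ^ 2 * A * H ^ 3 * l ^ 2 := by positivity
  have hp2 : 0 ≤ S ^ 2 * A * H ^ 2 * E₁ * l ^ 2 := by positivity
  have hp3 : 0 ≤ S ^ 2 * A * H ^ 2 * E₂ * l ^ 2 := by positivity
  rw [h1]
  calc _ ≤ 3 * H * (28 * (H * r * l ^ 2) +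
        S * H * (6 * H + 10 * E₁ + 3 * E₂) * l * (3 * (S * A) * l)) :=
        mul_le_mul_of_nonneg_left (by linarith) (by positivity)
    _ = 84 * (H ^ 2 * r * l ^ 2) + 54 * (S ^ 2 * A * H ^ 3 * l ^ 2) +
        90 * (S ^ 2 * A * H ^ 2 * E₁ * l ^ 2) + 27 * (S ^ 2 * A * H ^ 2 * E₂ * l ^ 2) := by ring
    _ ≤ _ := by linarith

end Final

end PrivateRL
theorem theorem2 :
    ∃ (C : ℝ) (p : ℕ), 0 < C ∧
      ∀ (S A Ω : Type*) [Fintype S] [Fintype A] [Nonempty A]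
        (H K : ℕ) (_ : 0 < H) (_ : 0 < K)
        (M : PrivateRL.MDP S A H) (s₁ : Fin K → S)
        (E₁ E₂ : ℝ → ℝ → ℝ)
        (_ : ∀ ε δ, 0 < ε → 0 < δ → δ ≤ 1 → 0 < E₁ ε δ ∧ 0 < E₂ ε δ)
        (ε δ : ℝ) (_ : 0 < ε) (_ : 0 < δ) (_ : δ ≤ 1)
        (mΩ : MeasurableSpace Ω) (μ : Measure Ω) [IsProbabilityMeasure μ]
        (ℱ : Filtration ℕ mΩ) (R : PrivateRL.Run Ω S A H K)
        (_ : PrivateRL.IsUCBVIRun μ ℱ M s₁ (δ / 2) (E₁ ε (δ / 2)) (E₂ ε (δ / 2)) R)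
        (_ : 1 - δ / 2 ≤ μ.real {ω | R.Accurate (E₁ ε (δ / 2)) (E₂ ε (δ / 2)) ω}),
        1 - δ ≤ μ.real {ω | R.regret M s₁ ω ≤
          C * (Real.sqrt ((Fintype.card S : ℝ) * (Fintype.card A : ℝ) * (H : ℝ) ^ 3
                  * ((K : ℝ) * (H : ℝ)))
              + (Fintype.card S : ℝ) ^ 2 * (Fintype.card A : ℝ) * (H : ℝ) ^ 3
              + (Fintype.card S : ℝ) ^ 2 * (Fintype.card A : ℝ) * (H : ℝ) ^ 2 * E₁ ε (δ / 2)
              + (Fintype.card S : ℝ) ^ 2 * (Fintype.card A : ℝ) * (H : ℝ) ^ 2 * E₂ ε (δ / 2))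
            * Real.log (6 * (Fintype.card S : ℝ) * (Fintype.card A : ℝ)
                  * ((K : ℝ) * (H : ℝ)) / δ) ^ p} := by
  refine ⟨100, 2, by norm_num, ?_⟩
  intro S A Ω _ _ _ H K hH hK M s₁ E₁ E₂ hE ε δ hε hδ hδ1 mΩ μ _ ℱ R hR hacc
  obtain ⟨hE₁, hE₂⟩ := hE ε (δ / 2) hε (by linarith) (by linarith)
  have : Nonempty S := ⟨s₁ ⟨0, hK⟩⟩
  have hSr : (1 : ℝ) ≤ Fintype.card S := by exact_mod_cast Fintype.card_pos
  have hAr : (1 : ℝ) ≤ Fintype.card A := by exact_mod_cast Fintype.card_pos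
  have hHr : (1 : ℝ) ≤ H := by exact_mod_cast hH
  have hKr : (1 : ℝ) ≤ K := by exact_mod_cast hK
  set u : ℝ := (Fintype.card S : ℝ) * (Fintype.card A : ℝ) * ((K : ℝ) * (H : ℝ)) with hu
  have hKu : (K : ℝ) ≤ u := by
    calc (K : ℝ) ≤ K * H := le_mul_of_one_le_right (by linarith) hHr
      _ ≤ u := le_mul_of_one_le_left (by positivity) (one_le_mul_of_one_le_of_one_le hSr hAr)
  have hu1 : 1 ≤ u := hKr.trans hKu
  have hu0 : 0 < u := by linarith
  have hu6 : 6 * u ≤ 6 * u / δ := by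
    rw [le_div_iff₀ hδ]; exact mul_le_of_le_one_right (by positivity) hδ1
  set l : ℝ := Real.log (6 * u / δ) with hl
  have hl' : Real.log (6 * (Fintype.card S : ℝ) * (Fintype.card A : ℝ)
      * ((K : ℝ) * (H : ℝ)) / δ) = l := by
    rw [hl, hu]; congr 1; ring
  have hl1 : 1 ≤ l := by
    rw [hl, Real.le_log_iff_exp_le (by positivity)]
    linarith [Real.exp_one_lt_d9]
  -- The radicand of `Lc` at the input level `δ / 2`, so that `Lc = √x` holds by `rfl`.
  set x : ℝ := 2 * Real.log (4 * (Fintype.card S : ℝ) * (Fintype.card A : ℝ) *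
    ((K : ℝ) * (H : ℝ)) / (δ / 2)) with hx
  have hx8 : x = 2 * Real.log (8 * u / δ) := by
    rw [hx, hu]; congr 2; field_simp; norm_num
  have hu8 : 8 ≤ 8 * u / δ := by
    rw [le_div_iff₀ hδ]; nlinarith
  have hx0 : 0 < x := by
    rw [hx8]
    have := Real.log_pos (show 1 < 8 * u / δ by linarith)
    linarith
  have hxl : x ≤ 4 * l := by
    -- Squaring absorbs the change of constant from `8` to `6`, because `6 * u / δ ≥ 6`.
    have h1 : Real.log (8 * u / δ) ≤ Real.log ((6 * u / δ) ^ 2) := by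
      apply Real.log_le_log (by linarith)
      have : 6 ≤ 6 * u / δ := by linarith
      have h2 : 8 * u / δ = 8 / 6 * (6 * u / δ) := by ring
      rw [h2]
      nlinarith
    rw [Real.log_pow] at h1
    push_cast at h1
    rw [hx8]
    linarith
  have hKl : Real.log ((K : ℝ) + 1) ≤ l :=
    Real.log_le_log (by positivity) (by linarith)
  rw [hl']
  have hbad := (hR.deviation_le ⟨K, δ / 2, E₁ ε (δ / 2), E₂ ε (δ / 2)⟩ hx0).trans
    (PrivateRL.failure_le hKr hHr hSr hAr (half_pos hδ) (by linarith))
  have hsub : {ω | R.Accurate (E₁ ε (δ / 2)) (E₂ ε (δ / 2)) ω} ⊆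
      {ω | R.regret M s₁ ω ≤
          100 * (Real.sqrt ((Fintype.card S : ℝ) * (Fintype.card A : ℝ) * (H : ℝ) ^ 3
                  * ((K : ℝ) * (H : ℝ)))
              + (Fintype.card S : ℝ) ^ 2 * (Fintype.card A : ℝ) * (H : ℝ) ^ 3
              + (Fintype.card S : ℝ) ^ 2 * (Fintype.card A : ℝ) * (H : ℝ) ^ 2 * E₁ ε (δ / 2)
              + (Fintype.card S : ℝ) ^ 2 * (Fintype.card A : ℝ) * (H : ℝ) ^ 2 * E₂ ε (δ / 2))
            * l ^ 2} ∪
      PrivateRL.deviation M R ⟨K, δ / 2, E₁ ε (δ / 2), E₂ ε (δ / 2)⟩ x := by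
    intro ω hω
    by_cases hdev : ω ∈ PrivateRL.deviation M R ⟨K, δ / 2, E₁ ε (δ / 2), E₂ ε (δ / 2)⟩ x
    · exact Or.inr hdev
    left
    have hgap : ∀ h : Fin H, ω ∉ PrivateRL.gapDeviation M R
        ⟨K, δ / 2, E₁ ε (δ / 2), E₂ ε (δ / 2)⟩ x h := fun h hh =>
      hdev (Or.inr (Or.inr (Set.mem_iUnion.2 ⟨h, hh⟩)))
    refine (PrivateRL.Run.regret_le (p := ⟨K, δ / 2, E₁ ε (δ / 2), E₂ ε (δ / 2)⟩) (x := x)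
      (X := 2 * H * Real.sqrt (K * x / 2)) rfl hx0.le hE₁.le hE₂.le (by positivity)
      (fun k => hR.state_init k ω) (fun k => hR.policy_greedy k ω) (fun k => hω k)
      (PrivateRL.Run.concentrated_of_notMem hdev) (fun h => not_lt.1 (hgap h))).trans ?_
    exact PrivateRL.final_bound_le hKr hHr hSr hAr hE₁.le hE₂.le hl1 hx0.le hxl hKl
  -- Monotonicity and subadditivity hold for arbitrary sets, so neither the accuracy event nor the
  -- regret event has to be measurable. Inaccuracy and deviation each cost `δ / 2`.
  have h1 := (measureReal_mono (μ := μ) hsub (measure_ne_top _ _)).trans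
    (measureReal_union_le _ _)
  linarith
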